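/- Let $(G,\Gamma,p,\pi)$ be a planar non-crossing periodic framework: $G$ is a connected simple graph with finite vertex degrees; $\Gamma\subset\mathrm{Aut}(G)$ is free abelian of rank two and acts without fixed vertices or edges and with finitely many vertex and edge orbits; $\pi:\Gamma\to\mathbb R^2$ is an injective homomorphism onto a rank-two lattice $\Lambda$ of translations; $p$ maps the vertices to $\mathbb R^2$, with $p(u)\ne p(v)$ for each edge $\{u,v\}$ and $p(\gamma v)=p(v)+\pi(\gamma)$; the closed segments $[p(u),p(v)]$ of two distinct edges meet at most in a common endpoint. The faces are the connected components of the complement in $\mathbb R^2$ of the vertices and edge segments, and the boundary of each face is assumed to be a simple finite polygon formed by edges of the framework. A tetrad $(u,v,U,V)$ consists of an oriented edge $(u,v)$, the face $U$ to the right of the segment from $p(u)$ to $p(v)$, and the face $V$ to its left. A face-path $U\to V$ is a finite sequence of faces $U=U_0,U_1,\dots,U_n=V$ with tetrads whose faces are $U_i,U_{i+1}$; write $p_i,q_i\in\mathbb R^2$ for the placed initial and final endpoints of the oriented edge of the $i$-th tetrad and $s_i$ for the value of $s$ on this edge. Put $(x,y)^\perp=(-y,x)$ and $|a\ b|=\det(a\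 b)$. A real function $s$ on the edges is a $\Gamma$-invariant equilibrium stress if it is constant on $\Gamma$-orbits and $\sum_{v:\{u,v\}\in E}s_{uv}(p(v)-p(u))=0$ for each vertex $u$. A lifting is a continuous $H:\mathbb R^2\to\mathbb R$ with $H(q)=\nu_U\cdot q+C_U$ on each face $U$; it is periodic if $H(q+\lambda)=H(q)$ for all $q\in\mathbb R^2$, $\lambda\in\Lambda$; it induces $s$ if $\nu_V-\nu_U=s_{uv}(p(v)-p(u))^\perp$ for every tetrad $(u,v,U,V)$. **Proposition.** Let $s$ be a $\Gamma$-invariant equilibrium stress. Suppose that for some face $U_0$, some generators $\lambda_1,\lambda_2$ of $\Lambda$ and some face-paths $U_0\to U_0+\lambda_j$, $$\sum_{U_0\to U_0+\lambda_j}s_i(q_i-p_i)=0,\qquad j=1,2.$$ Then for each face $U$ and each $\lambda\in\Lambda$ there is a face-path $U\to U+\lambda$, and for each $C_0\in\mathbb R$ there is exactly one lifting $H\equiv(\nu_U,C_U)$ such that $C_{U_0}=C_0$ and $$\nu_U\cdot\lambda=\sum_{U\to U+\lambda}s_i|q_i\ p_i|=C_U-C_{U+\lambda}$$ for all faces $U$,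 all $\lambda\in\Lambda$ and all face-paths $U\to U+\lambda$. Moreover, a lifting satisfies these relations if and only if it is periodic and induces $s$. -/

import Mathlib

open scoped InnerProductSpace Topology

/-- The Euclidean plane. -/
abbrev Plane : Type := EuclideanSpace ℝ (Fin 2)

/-- `perp (x, y) = (-y, x)`. -/
noncomputable def perp (a : Plane) : Plane := !₂[-(a 1), a 0]

/-- The determinant `|a b|` of the 2 × 2 matrix with columns `a`, `b`. -/
def det2 (a b : Plane) : ℝ := a 0 * b 1 - a 1 * b 0

/-- The closed straight segment on which the placement `p` puts the edge `e`. -/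
def edgeSegment {V : Type*} (p : V → Plane) (e : Sym2 V) : Set Plane :=
  convexHull ℝ (p '' {v | v ∈ e})

/-- The points of the plane covered by a geometric graph: its vertices and its edge segments. -/
def skeletonOf {V : Type*} (G : SimpleGraph V) (p : V → Plane) : Set Plane :=
  Set.range p ∪ ⋃ e ∈ G.edgeSet, edgeSegment p e

/-- The faces of a geometric graph: the connected components of the complement in the plane. -/
def IsFaceOf {V : Type*} (G : SimpleGraph V) (p : V → Plane) (U : Set Plane) : Prop :=
  ∃ x ∈ (skeletonOf G p)ᶜ, connectedComponentIn (skeletonOf G p)ᶜ x = U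

/-- A planar non-crossing periodic framework `(G, Γ, p, π)`. -/
structure PeriodicFramework (V : Type*) where
  /-- The graph `G`; it is simple, connected and has finite vertex degrees. -/
  graph : SimpleGraph V
  connected : graph.Connected
  finite_degree : ∀ v, (graph.neighborSet v).Finite
  /-- The periodicity group `Γ`, free abelian of rank two. -/
  Γ : Subgroup (graph ≃g graph)
  free_rank_two : Nonempty (Γ ≃* Multiplicative (ℤ × ℤ))
  /-- `Γ` acts without fixed vertices and without fixed edges. -/
  no_fixed_vertex : ∀ γ ∈ Γ, γ ≠ 1 → ∀ v, γ v ≠ v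
  no_fixed_edge : ∀ γ ∈ Γ, γ ≠ 1 → ∀ e ∈ graph.edgeSet, e.map γ ≠ e
  /-- The quotient multigraph is finite. -/
  finite_vertex_orbits : ∃ S : Set V, S.Finite ∧ ∀ v, ∃ γ ∈ Γ, γ v ∈ S
  finite_edge_orbits : ∃ S : Set (Sym2 V), S.Finite ∧ ∀ e ∈ graph.edgeSet, ∃ γ ∈ Γ, e.map γ ∈ S
  /-- The placement of the vertices. -/
  p : V → Plane
  p_ne : ∀ u v, graph.Adj u v → p u ≠ p v
  /-- The faithful representation of `Γ` by translations of the plane. -/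
  π : Additive Γ →+ Plane
  π_injective : Function.Injective π
  /-- The image of `π` is a lattice of rank two. -/
  discrete : DiscreteTopology π.range
  spans : Submodule.span ℝ (π.range : Set Plane) = ⊤
  /-- The placement is periodic. -/
  p_smul : ∀ (γ : Γ) (v : V), p ((γ : graph ≃g graph) v) = p v + π (Additive.ofMul γ)
  /-- Two distinct edges have disjoint closed segments, except for a common endpoint. -/
  non_crossing : ∀ e ∈ graph.edgeSet, ∀ e' ∈ graph.edgeSet, e ≠ e' →
    edgeSegment p e ∩ edgeSegment p e' ⊆ p '' {v | v ∈ e ∧ v ∈ e'}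
  /-- The boundary of each face is a simple finite polygon, formed by a cycle of the graph. -/
  face_boundary : ∀ U, IsFaceOf graph p U → ∃ (v : V) (c : graph.Walk v v), c.IsCycle ∧
    frontier U = ⋃ e ∈ c.edges, edgeSegment p e

namespace PeriodicFramework

variable {V : Type*} (F : PeriodicFramework V)

/-- The period lattice `Λ = π(Γ)`. -/
def lattice : AddSubgroup Plane := F.π.range

/-- The points covered by the vertices and edges of the framework. -/
def skeleton : Set Plane := skeletonOf F.graph F.p

/-- The faces of the framework, as open plane domains. -/
def Face : Type := {U : Set Plane // IsFaceOf F.graph F.p U}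

theorem add_mem_skeleton (l : F.lattice) {x : Plane} (hx : x ∈ F.skeleton) :
    x + (l : Plane) ∈ F.skeleton := by
  obtain ⟨l, γ, rfl⟩ := l
  obtain ⟨γ, rfl⟩ : ∃ g : F.Γ, Additive.ofMul g = γ := ⟨γ.toMul, rfl⟩
  rcases hx with ⟨v, rfl⟩ | hx
  · exact Or.inl ⟨_, F.p_smul γ v⟩
  · right
    simp only [Set.mem_iUnion] at hx ⊢
    obtain ⟨e, he, hx⟩ := hx
    refine ⟨e.map (γ : F.graph ≃g F.graph), ?_, ?_⟩
    · induction e with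
      | _ a b =>
        rw [Sym2.map_mk, SimpleGraph.mem_edgeSet]
        exact (γ : F.graph ≃g F.graph).map_rel_iff.2 he
    · have h1 : x + F.π (Additive.ofMul γ) ∈
          (fun y => y + F.π (Additive.ofMul γ)) '' edgeSegment F.p e := ⟨x, hx, rfl⟩
      have h2 : ∀ t : Plane, ∀ s : Set Plane,
          (fun y => y + t) '' convexHull ℝ s = convexHull ℝ ((fun y => y + t) '' s) := by
        intro t s
        have := (AffineEquiv.vaddConst ℝ t : Plane ≃ᵃ[ℝ] Plane).toAffineMap.image_convexHull s
        exact this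
      rw [edgeSegment, h2] at h1
      refine convexHull_mono ?_ h1
      rintro _ ⟨_, ⟨v, hv, rfl⟩, rfl⟩
      exact ⟨(γ : F.graph ≃g F.graph) v, Sym2.mem_map.2 ⟨v, hv, rfl⟩, F.p_smul γ v⟩

theorem add_mem_skeleton_iff (l : F.lattice) {x : Plane} :
    x + (l : Plane) ∈ F.skeleton ↔ x ∈ F.skeleton := by
  refine ⟨fun h => ?_, F.add_mem_skeleton l⟩
  simpa using F.add_mem_skeleton (-l) h

theorem isFaceOf_translate (U : F.Face) (l : F.lattice) :
    IsFaceOf F.graph F.p ((fun x => x + (l : Plane)) '' U.1) := by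
  obtain ⟨U, x, hx, rfl⟩ := U
  refine ⟨x + l, fun h => hx ((F.add_mem_skeleton_iff l).1 h), ?_⟩
  have h := (Homeomorph.addRight (l : Plane)).image_connectedComponentIn hx
  have h3 : (Homeomorph.addRight (l : Plane)) '' (skeletonOf F.graph F.p)ᶜ
      = (skeletonOf F.graph F.p)ᶜ := by
    ext y
    constructor
    · rintro ⟨z, hz, rfl⟩ h
      exact hz ((F.add_mem_skeleton_iff l).1 h)
    · intro hy
      refine ⟨y + ((-l : F.lattice) : Plane), fun h => hy ((F.add_mem_skeleton_iff (-l)).1 h), ?_⟩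
      simp
  rw [h3] at h
  exact h.symm

/-- The translate `U + l` of a face by a period. -/
def translate (U : F.Face) (l : F.lattice) : F.Face :=
  ⟨(fun x => x + (l : Plane)) '' U.1, F.isFaceOf_translate U l⟩

/-- `(u, v, U, W)` is a tetrad: `{u, v}` is an edge, the face `W` lies along the left side of the
oriented segment from `p u` to `p v` (which thus runs counter-clockwise around `W`), and the face
`U` lies along its right side (the segment runs clockwise around `U`). -/
def IsTetrad (u v : V) (U W : F.Face) : Prop :=
  F.graph.Adj u v ∧ ∀ x ∈ openSegment ℝ (F.p u) (F.p v), ∀ᶠ ε : ℝ in 𝓝[>] 0,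
    x + ε • perp (F.p v - F.p u) ∈ W.1 ∧ x - ε • perp (F.p v - F.p u) ∈ U.1

/-- A face-path: a sequence of faces with successive tetrads `(pᵢ, qᵢ, Uᵢ, Uᵢ₊₁)`. -/
inductive FacePath : F.Face → F.Face → Type _
  | nil (U : F.Face) : FacePath U U
  | cons {U W X : F.Face} (u v : V) (h : F.IsTetrad u v U W) (P : FacePath W X) : FacePath U X

variable {F}

/-- The sum of `sᵢ (qᵢ - pᵢ)` along a face-path. -/
noncomputable def FacePath.edgeSum (s : Sym2 V → ℝ) :
    {U W : F.Face} → F.FacePath U W → Plane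
  | _, _, .nil _ => 0
  | _, _, .cons u v _ P => s s(u, v) • (F.p v - F.p u) + P.edgeSum s

/-- The sum of `sᵢ |qᵢ pᵢ|` along a face-path. -/
noncomputable def FacePath.detSum (s : Sym2 V → ℝ) :
    {U W : F.Face} → F.FacePath U W → ℝ
  | _, _, .nil _ => 0
  | _, _, .cons u v _ P => s s(u, v) * det2 (F.p v) (F.p u) + P.detSum s

variable (F)

/-- `s` is an equilibrium stress (only the values of `s` on edges of the graph matter). -/
def IsEquilibriumStress (s : Sym2 V → ℝ) : Prop :=
  ∀ u, ∑ v ∈ (F.finite_degree u).toFinset, s s(u, v) • (F.p v - F.p u) = 0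

/-- `s` is constant on the edge orbits of `Γ`. -/
def IsInvariantStress (s : Sym2 V → ℝ) : Prop :=
  ∀ γ ∈ F.Γ, ∀ e ∈ F.graph.edgeSet, s (e.map γ) = s e

/-- A lifting: a continuous height function which is affine on each face, together with its
coefficients there, `H(q) = ν_U · q + C_U` for `q ∈ U`. -/
structure Lifting where
  /-- The height function `H`. -/
  height : Plane → ℝ
  /-- The vectors `ν_U`. -/
  normal : F.Face → Plane
  /-- The constants `C_U`. -/
  const : F.Face → ℝ
  continuous_height : Continuous height
  height_eq : ∀ U : F.Face, ∀ q ∈ U.1, height q = ⟪normal U, q⟫_ℝ + const U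

variable {F}

/-- The lifting is invariant under the period lattice. -/
def Lifting.IsPeriodic (L : F.Lifting) : Prop :=
  ∀ (x : Plane) (l : F.lattice), L.height (x + (l : Plane)) = L.height x

/-- The stress associated to the lifting is `s`: `ν_W - ν_U = s_{uv} (p(v) - p(u))^⊥`
for each tetrad `(u, v, U, W)`. -/
def Lifting.Induces (L : F.Lifting) (s : Sym2 V → ℝ) : Prop :=
  ∀ (u v : V) (U W : F.Face), F.IsTetrad u v U W →
    L.normal W - L.normal U = s s(u, v) • perp (F.p v - F.p u)

/-- The relations `ν_U · l = ∑ sᵢ |qᵢ pᵢ| = C_U - C_{U + l}`, for all faces `U`, all periods `l`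
and all face-paths from `U` to `U + l`. -/
def Lifting.HasPeriodRelations (L : F.Lifting) (s : Sym2 V → ℝ) : Prop :=
  ∀ (U : F.Face) (l : F.lattice) (P : F.FacePath U (F.translate U l)),
    ⟪L.normal U, (l : Plane)⟫_ℝ = P.detSum s ∧
      P.detSum s = L.const U - L.const (F.translate U l)

end PeriodicFramework

/-! The coefficients of a lifting inducing `s` form a function `g = (ν, C)` on the faces. Across an
oriented edge `(u, v)`, from right to left, `ν` must jump by `s (p v - p u)^⊥`, and continuity along
the edge forces `C` to jump by `-s |p v p u|`. Such a `g` (`IsPotential`) exists because these jumps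
are antisymmetric and, by equilibrium, sum to zero around every vertex: they form a closed cocycle
on the simply connected plane.

The integration is done on functions of the plane rather than on the dual graph. Near a vertex an
explicit combination of branches of the argument has the required jumps
(`exists_localSolution_vertex`). Two local solutions differ by a locally constant function, because
removing the countable set of vertices does not disconnect a ball (`constNear_of_hasJumpsAt`). A
monodromy argument along rays then glues (`exists_global_solution`). The same local constancy makes
the dual graph connected (`nonempty_facePath`), so `g` is unique up to a constant. The height
extends continuously over the edges because the jumps vanish as affine functions there, and over the
vertices because `ν` is locally bounded (`exists_tendsto_height`).

As for the periods, invariance of `s` makes `ν_{U+λ} - ν_U` independent of `U`, and the hypothesis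
on the two face-paths makes it zero. Then `κ(λ) = C_{U+λ} + ν_U·λ - C_U` is independent of `U` and
additive in `λ`. Adding one constant vector to all `ν_U` kills it, which fixes `ν` completely and
leaves only the constant height free (`exists_periodic_potential`). Since sums along face-paths
telescope, `κ = 0` is precisely the period relations; conversely these determine `ν_U` through its
inner products with the spanning lattice. -/

/-! ### Functions that are locally constant off a thin set -/

section LocallyConstant

open Set Filter Metric

variable {E : Type*}

/-- Off the set `S`, the function `f` is constant near `y`. -/
def ConstNear {X : Type*} [TopologicalSpace E] (S : Set E) (f : E → X) (y : E) : Prop :=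
  ∃ a, ∀ᶠ z in 𝓝[Sᶜ] y, f z = a

/-- The local value `a y` of `f` near `y` is locally constant on `T`: for `w` near `y`, both `a w`
and `a y` are values of `f` at points near `w` off `S`, and such points exist by density. With the
discrete topology on `X`, `a` is thus continuous on a preconnected set. -/
theorem IsPreconnected.eq_of_constNear {X : Type*} [TopologicalSpace E] {S T : Set E}
    (hS : Dense Sᶜ) (hT : IsPreconnected T) {f : E → X} (hf : ∀ y ∈ T, ConstNear S f y)
    {y z : E} (hy : y ∈ T) (hyS : y ∉ S) (hz : z ∈ T) (hzS : z ∉ S) : f y = f z := by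
  classical
  let a : E → X := fun y => if h : y ∈ T then (hf y h).choose else f y
  have ha : ∀ y ∈ T, ∀ᶠ z in 𝓝[Sᶜ] y, f z = a y := fun y h => by
    simpa only [a, dif_pos h] using (hf y h).choose_spec
  have hself : ∀ y ∈ T, y ∉ S → f y = a y := fun y h hyS => (ha y h).self_of_nhdsWithin hyS
  let _ : TopologicalSpace X := ⊥
  have : DiscreteTopology X := ⟨rfl⟩
  have hc : ContinuousOn a T := by
    intro y h
    have h1 : ∀ᶠ w in 𝓝[T] y, a w = a y := by
      have h2 := eventually_eventually_nhds.2 (eventually_nhdsWithin_iff.1 (ha y h))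
      filter_upwards [nhdsWithin_le_nhds h2, self_mem_nhdsWithin] with w hw hwT
      have h3 := (eventually_nhdsWithin_iff.2 hw).and (ha w hwT)
      have : (𝓝[Sᶜ] w).NeBot := mem_closure_iff_nhdsWithin_neBot.1 (hS w)
      obtain ⟨q, hq⟩ := h3.exists
      exact hq.2.symm.trans hq.1
    exact tendsto_nhds_of_eventually_eq h1
  rw [hself y hy hyS, hself z hz hzS]
  exact hT.constant hc hy hz

/-- The ball is homeomorphic to the whole space, where complements of countable sets are connected.
-/
theorem isPreconnected_ball_diff_countable [NormedAddCommGroup E] [InnerProductSpace ℝ E]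
    (h : 1 < Module.rank ℝ E) (x : E) {r : ℝ} (hr : 0 < r) {C : Set E} (hC : C.Countable) :
    IsPreconnected (ball x r \ C) := by
  let φ := OpenPartialHomeomorph.univBall x r
  have hinj : Function.Injective φ := by
    have := φ.injOn
    rwa [OpenPartialHomeomorph.univBall_source, injOn_univ] at this
  have h1 := (hC.preimage hinj).isConnected_compl_of_one_lt_rank h
  have h2 := h1.isPreconnected.image φ (OpenPartialHomeomorph.continuous_univBall x r).continuousOn
  convert h2 using 1
  ext y
  constructor
  · rintro ⟨hy, hyC⟩
    rw [← OpenPartialHomeomorph.univBall_target x hr] at hy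
    exact ⟨φ.symm y, by simpa [φ.right_inv hy] using hyC, φ.right_inv hy⟩
  · rintro ⟨z, hz, rfl⟩
    refine ⟨?_, hz⟩
    rw [← OpenPartialHomeomorph.univBall_target x hr]
    exact φ.map_source (by simp [φ])

/-- Countable sets of exceptional points are removable, since a small ball without them is still
connected. Vertices will play this role. -/
theorem constNear_of_diff_countable {X : Type*} [NormedAddCommGroup E] [InnerProductSpace ℝ E]
    (h : 1 < Module.rank ℝ E) {S C O : Set E} (hS : Dense Sᶜ) (hC : C.Countable) (hCS : C ⊆ S)
    (hO : IsOpen O) {f : E → X} (hf : ∀ y ∈ O, y ∉ C → ConstNear S f y) {x : E} (hx : x ∈ O) :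
    ConstNear S f x := by
  obtain ⟨r, hr, hrO⟩ := Metric.isOpen_iff.1 hO x hx
  have hp := isPreconnected_ball_diff_countable h x hr hC
  obtain ⟨z, hzb, hzS⟩ := hS.exists_dist_lt x hr
  have hz : z ∈ ball x r := by rwa [mem_ball, dist_comm]
  refine ⟨f z, ?_⟩
  filter_upwards [nhdsWithin_le_nhds (ball_mem_nhds x hr), self_mem_nhdsWithin] with w hw hwS
  exact hp.eq_of_constNear hS (fun y hy => hf y (hrO hy.1) hy.2)
    ⟨hw, fun h => hwS (hCS h)⟩ hwS ⟨hz, fun h => hzb (hCS h)⟩ hzb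

end LocallyConstant

/-! ### Gluing local solutions on a normed space -/

section Gluing

open Set Filter Metric

variable {E M : Type*} [NormedAddCommGroup E] [NormedSpace ℝ E] [AddCommGroup M]

/-- A local condition on functions whose solutions exist locally, are unique up to additive
constants, and may be glued, has a global solution. -/
theorem exists_global_solution {S : Set E} (hS : Dense Sᶜ) (Good : (E → M) → E → Prop)
    (h_open : ∀ f x, Good f x → ∀ᶠ y in 𝓝 x, Good f y)
    (h_congr : ∀ f g x, f =ᶠ[𝓝[Sᶜ] x] g → Good f x → Good g x)
    (h_add : ∀ f x (c : M), Good f x → Good (fun z => f z + c) x)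
    (h_uniq : ∀ f g x, Good f x → Good g x → ConstNear S (fun z => f z - g z) x)
    (h_ex : ∀ x, ∃ f, Good f x) : ∃ f, ∀ x, Good f x := by
  classical
  have hopen : ∀ f, IsOpen {x | Good f x} := fun f => isOpen_iff_mem_nhds.2 (h_open f)
  -- The segment from the origin to `t • x`.
  let K : E → ℝ → Set E := fun x t => (fun τ : ℝ => τ • x) '' uIcc 0 t
  have hKcompact : ∀ x t, IsCompact (K x t) := fun x t =>
    isCompact_uIcc.image (by fun_prop)
  have hKconvex : ∀ x t, Convex ℝ (K x t) := fun x t =>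
    (convex_uIcc (0 : ℝ) t).is_linear_image
      ⟨fun a b => add_smul a b x, fun a b => mul_smul a b x⟩
  have hK0 : ∀ x t, (0 : E) ∈ K x t := fun x t => ⟨0, left_mem_uIcc, zero_smul ℝ x⟩
  have hK1 : ∀ x, x ∈ K x 1 := fun x => ⟨1, right_mem_uIcc, one_smul ℝ x⟩
  -- solutions along rays
  have hray : ∀ x, ∃ f, ∀ y ∈ K x 1, Good f y := by
    intro x
    let A : ℝ → Prop := fun t => ∃ f, ∀ y ∈ K x t, Good f y
    have hA0 : A 0 := by
      obtain ⟨f, hf⟩ := h_ex 0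
      refine ⟨f, ?_⟩
      rintro _ ⟨τ, hτ, rfl⟩
      have : τ = 0 := by simpa using hτ
      simpa [this] using hf
    -- Solvability along the segment is locally constant in `t`: a solution near `K x t'` is
    -- continued by a local solution `g` at `t • x`, shifted by the constant by which the two differ
    -- on a convex overlap.
    have hstep : ∀ t, ∃ N ∈ 𝓝 t, ∀ t' ∈ N, ∀ t'' ∈ N, A t' → A t'' := by
      intro t
      obtain ⟨g, hg⟩ := h_ex (t • x)
      obtain ⟨r, hr, hrg⟩ := Metric.isOpen_iff.1 (hopen g) _ hg
      have hc : ContinuousAt (fun τ : ℝ => τ • x) t := by fun_prop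
      obtain ⟨ε, hε, hεr⟩ := Metric.mem_nhds_iff.1 (hc (ball_mem_nhds _ hr))
      refine ⟨ball t ε, ball_mem_nhds _ hε, fun t' ht' t'' ht'' => ?_⟩
      rintro ⟨f, hf⟩
      obtain ⟨δ, hδ, hδf⟩ := (hKcompact x t').exists_thickening_subset_open (hopen f) hf
      let O := thickening δ (K x t')
      have hO : IsOpen O := isOpen_thickening
      have hOB : Convex ℝ (O ∩ ball (t • x) r) :=
        ((hKconvex x t').thickening δ).inter (convex_ball _ _)
      have hne : (t' • x) ∈ O ∩ ball (t • x) r :=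
        ⟨self_subset_thickening hδ _ ⟨t', right_mem_uIcc, rfl⟩, hεr ht'⟩
      obtain ⟨w, ⟨hwO, hwB⟩, hwS⟩ :=
        hS.inter_open_nonempty _ (hO.inter isOpen_ball) ⟨_, hne⟩
      let c := f w - g w
      have hcc : ∀ z ∈ O ∩ ball (t • x) r, z ∉ S → f z = g z + c := by
        intro z hz hzS
        have := hOB.isPreconnected.eq_of_constNear hS
          (f := fun z => f z - g z) (fun y hy => h_uniq f g y (hδf hy.1) (hrg hy.2)) hz hzS
          ⟨hwO, hwB⟩ hwS
        exact sub_eq_iff_eq_add'.1 this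
      refine ⟨fun z => if z ∈ O then f z else g z + c, fun y hy => ?_⟩
      by_cases hyO : y ∈ O
      · refine h_congr f _ y ?_ (hδf hyO)
        filter_upwards [nhdsWithin_le_nhds (hO.mem_nhds hyO)] with z hz
        simp [hz]
      · have hyB : y ∈ ball (t • x) r := by
          obtain ⟨τ, hτ, rfl⟩ := hy
          rcases uIcc_subset_uIcc_union_uIcc (b := t') hτ with h | h
          · exact absurd (self_subset_thickening hδ (K x t') ⟨τ, h, rfl⟩) hyO
          · apply hεr
            exact (convex_ball t ε).ordConnected.uIcc_subset ht' ht'' h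
        refine h_congr _ _ y ?_ (h_add g y c (hrg hyB))
        filter_upwards [nhdsWithin_le_nhds (isOpen_ball.mem_nhds hyB), self_mem_nhdsWithin]
          with z hz hzS
        split_ifs with hzO
        · exact (hcc z ⟨hzO, hz⟩ hzS).symm
        · rfl
    have hA : A 0 = A 1 := by
      refine (isPreconnected_univ (α := ℝ)).eq_of_constNear (S := ∅) (by simp) (f := A) ?_
        (mem_univ _) (by simp) (mem_univ _) (by simp)
      intro t _
      obtain ⟨N, hN, h⟩ := hstep t
      refine ⟨A t, ?_⟩
      filter_upwards [nhdsWithin_le_nhds hN] with t' ht'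
      exact propext ⟨h _ ht' _ (mem_of_mem_nhds hN), h _ (mem_of_mem_nhds hN) _ ht'⟩
    exact hA.mp hA0
  -- normalization at the origin
  obtain ⟨g, hg⟩ := h_ex 0
  have hray' : ∀ x, ∃ f, (∃ δ > 0, ∀ y ∈ thickening δ (K x 1), Good f y) ∧
      f =ᶠ[𝓝[Sᶜ] 0] g := by
    intro x
    obtain ⟨f, hf⟩ := hray x
    obtain ⟨c, hc⟩ := h_uniq f g 0 (hf 0 (hK0 x 1)) hg
    refine ⟨fun z => f z + -c, ?_, ?_⟩
    · obtain ⟨δ, hδ, h⟩ := (hKcompact x 1).exists_thickening_subset_open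
        (hopen fun z => f z + -c) (fun y hy => h_add f y _ (hf y hy))
      exact ⟨δ, hδ, h⟩
    · filter_upwards [hc] with z hz
      rw [← hz]
      abel
  choose f hf hfg using hray'
  choose δ hδ hδf using hf
  -- The diagonal is a solution near `x` because it agrees there with `f x`: for `y` near `x` the
  -- segment to `y` stays in the domain of `f x`, and `f x`, `f y` agree near the origin, hence on a
  -- convex set containing `0` and `y`.
  refine ⟨fun x => f x x, fun x => ?_⟩
  refine h_congr (f x) _ x ?_ (hδf x x (self_subset_thickening (hδ x) _ (hK1 x)))
  filter_upwards [nhdsWithin_le_nhds (ball_mem_nhds x (hδ x)), self_mem_nhdsWithin] with y hy hyS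
  have hKy : K y 1 ⊆ thickening (δ x) (K x 1) := by
    rintro _ ⟨τ, hτ, rfl⟩
    rw [mem_thickening_iff]
    refine ⟨τ • x, ⟨τ, hτ, rfl⟩, ?_⟩
    rw [uIcc_of_le zero_le_one] at hτ
    change dist (τ • y) (τ • x) < δ x
    rw [dist_eq_norm, ← smul_sub, norm_smul, Real.norm_of_nonneg hτ.1]
    rw [mem_ball, dist_eq_norm] at hy
    nlinarith [norm_nonneg (y - x), hτ.2, hτ.1]
  have hconv : Convex ℝ (thickening (δ x) (K x 1) ∩ thickening (δ y) (K y 1)) :=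
    ((hKconvex x 1).thickening _).inter ((hKconvex y 1).thickening _)
  have h0 : (0 : E) ∈ thickening (δ x) (K x 1) ∩ thickening (δ y) (K y 1) :=
    ⟨self_subset_thickening (hδ x) _ (hK0 x 1), self_subset_thickening (hδ y) _ (hK0 y 1)⟩
  have hO : thickening (δ x) (K x 1) ∩ thickening (δ y) (K y 1) ∈ 𝓝 (0 : E) :=
    (isOpen_thickening.inter isOpen_thickening).mem_nhds h0
  have : (𝓝[Sᶜ] (0 : E)).NeBot := mem_closure_iff_nhdsWithin_neBot.1 (hS 0)
  obtain ⟨w, ⟨⟨hwx, hwy⟩, hwO⟩, hwS⟩ :=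
    (((hfg x).and (hfg y)).and (nhdsWithin_le_nhds hO)).and self_mem_nhdsWithin |>.exists
  have := hconv.isPreconnected.eq_of_constNear hS (f := fun z => f x z - f y z)
    (fun z hz => h_uniq _ _ z (hδf x z hz.1) (hδf y z hz.2))
    ⟨hKy (hK1 y), self_subset_thickening (hδ y) _ (hK1 y)⟩ hyS hwO hwS
  simp only [hwx, hwy, sub_self] at this
  exact sub_eq_zero.1 this

end Gluing

/-! ### The determinant form of the plane -/

section Det

open Set Filter Metric

@[simp] theorem perp_apply_zero (a : Plane) : perp a 0 = -(a 1) := rfl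
@[simp] theorem perp_apply_one (a : Plane) : perp a 1 = a 0 := rfl

theorem Plane.ext' {a b : Plane} (h0 : a 0 = b 0) (h1 : a 1 = b 1) : a = b := by
  ext i
  fin_cases i
  · exact h0
  · exact h1

theorem det2_add_smul_perp (a z : Plane) (ε : ℝ) :
    det2 a (z + ε • perp a) = det2 a z + ε * (a 0 ^ 2 + a 1 ^ 2) := by
  simp [det2]
  ring

theorem sq_add_sq_pos_of_ne {a : Plane} (h : a ≠ 0) : 0 < a 0 ^ 2 + a 1 ^ 2 := by
  by_contra hn
  refine h (Plane.ext' ?_ ?_)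
  · simp
    nlinarith [sq_nonneg (a 0), sq_nonneg (a 1)]
  · simp
    nlinarith [sq_nonneg (a 0), sq_nonneg (a 1)]

theorem det2_swap (a b z : Plane) : det2 (a - b) (z - b) = -det2 (b - a) (z - a) := by
  simp [det2]
  ring

theorem continuous_det2_sub (a b : Plane) : Continuous fun z => det2 a (z - b) := by
  unfold det2
  fun_prop

theorem det2_eq_zero_of_mem_segment {a b z : Plane} (h : z ∈ segment ℝ a b) :
    det2 (b - a) (z - a) = 0 := by
  rw [segment_eq_image'] at h
  obtain ⟨t, -, rfl⟩ := h
  simp [det2]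
  ring

theorem eventually_mem_segment {a b y : Plane} (hab : a ≠ b) (hy : y ∈ openSegment ℝ a b) :
    ∀ᶠ z in 𝓝 y, det2 (b - a) (z - a) = 0 → z ∈ segment ℝ a b := by
  set d := b - a with hd
  have hN : 0 < d 0 ^ 2 + d 1 ^ 2 := sq_add_sq_pos_of_ne (sub_ne_zero.2 hab.symm)
  -- The parameter of the orthogonal projection of `z` to the line through `a` and `b`.
  let t : Plane → ℝ := fun z => ((z 0 - a 0) * d 0 + (z 1 - a 1) * d 1) / (d 0 ^ 2 + d 1 ^ 2)
  have ht : Continuous t := by unfold t; fun_prop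
  rw [openSegment_eq_image'] at hy
  obtain ⟨τ, hτ, rfl⟩ := hy
  have hty : t (a + τ • (b - a)) = τ := by
    simp only [t, ← hd]
    rw [div_eq_iff hN.ne']
    simp
    ring
  have h1 : ∀ᶠ z in 𝓝 (a + τ • (b - a)), t z ∈ Ioo (0 : ℝ) 1 :=
    ht.continuousAt (by rw [hty]; exact Ioo_mem_nhds hτ.1 hτ.2)
  filter_upwards [h1] with z hz hdet
  rw [segment_eq_image']
  refine ⟨t z, ⟨hz.1.le, hz.2.le⟩, ?_⟩
  simp only [det2, PiLp.sub_apply] at hdet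
  refine Plane.ext' ?_ ?_
  · simp only [PiLp.add_apply, PiLp.smul_apply, smul_eq_mul, ← hd, t]
    field_simp
    linear_combination d 1 * hdet
  · simp only [PiLp.add_apply, PiLp.smul_apply, smul_eq_mul, ← hd, t]
    field_simp
    linear_combination -d 0 * hdet

theorem dense_compl_segment (a b : Plane) : Dense (segment ℝ a b)ᶜ := by
  rcases eq_or_ne a b with rfl | hab
  · rw [segment_same]
    exact dense_compl_singleton a
  intro y
  by_cases hy : y ∈ segment ℝ a b
  swap
  · exact subset_closure hy
  have hN := sq_add_sq_pos_of_ne (sub_ne_zero.2 hab.symm)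
  have ht : Tendsto (fun ε : ℝ => y + ε • perp (b - a)) (𝓝[>] 0) (𝓝 y) := by
    have : Continuous fun ε : ℝ => y + ε • perp (b - a) := by fun_prop
    simpa using (this.tendsto 0).mono_left nhdsWithin_le_nhds
  refine mem_closure_of_tendsto ht ?_
  filter_upwards [self_mem_nhdsWithin] with ε hε hmem
  have h1 := det2_eq_zero_of_mem_segment hmem
  rw [add_sub_right_comm, det2_add_smul_perp, det2_eq_zero_of_mem_segment hy, zero_add] at h1
  exact (mul_pos hε hN).ne' h1

end Det

/-! ### Edges of a periodic framework -/

theorem edgeSegment_mk {V : Type*} (p : V → Plane) (u v : V) :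
    edgeSegment p s(u, v) = segment ℝ (p u) (p v) := by
  have : {w | w ∈ s(u, v)} = {u, v} := by ext w; simp
  rw [edgeSegment, this, Set.image_pair, convexHull_pair]

theorem isCompact_edgeSegment {V : Type*} (p : V → Plane) (e : Sym2 V) :
    IsCompact (edgeSegment p e) := by
  induction e with
  | _ a b =>
    rw [edgeSegment_mk, ← convexHull_pair]
    exact (Set.toFinite {p a, p b}).isCompact_convexHull (𝕜 := ℝ)

namespace PeriodicFramework

open Set Filter Metric

variable {V : Type*} (F : PeriodicFramework V)

theorem edgeSegment_map (γ : F.Γ) (e : Sym2 V) :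
    edgeSegment F.p (e.map (γ : F.graph ≃g F.graph)) =
      (fun y => y + F.π (Additive.ofMul γ)) '' edgeSegment F.p e := by
  have h := (AffineEquiv.vaddConst ℝ (F.π (Additive.ofMul γ)) :
    Plane ≃ᵃ[ℝ] Plane).toAffineMap.image_convexHull (F.p '' {v | v ∈ e})
  refine Eq.trans ?_ h.symm
  rw [edgeSegment]
  congr 1
  ext z
  constructor
  · rintro ⟨w, hw, rfl⟩
    obtain ⟨v, hv, rfl⟩ := Sym2.mem_map.1 hw
    exact ⟨F.p v, ⟨v, hv, rfl⟩, (F.p_smul γ v).symm⟩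
  · rintro ⟨_, ⟨v, hv, rfl⟩, rfl⟩
    exact ⟨_, Sym2.mem_map.2 ⟨v, hv, rfl⟩, F.p_smul γ v⟩

theorem countable_Γ : Countable F.Γ := by
  obtain ⟨φ⟩ := F.free_rank_two
  exact (φ.toEquiv.trans Multiplicative.toAdd).injective.countable

theorem countable_vertices (F : PeriodicFramework V) : Countable V := by
  obtain ⟨S, hS, h⟩ := F.finite_vertex_orbits
  have := F.countable_Γ
  have : Countable S := hS.countable
  refine Function.Surjective.countable (f := fun x : F.Γ × S => (x.1 : F.graph ≃g F.graph) x.2) ?_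
  intro v
  obtain ⟨γ, hγ, hv⟩ := h v
  exact ⟨(⟨γ, hγ⟩⁻¹, ⟨_, hv⟩), by simp⟩

/-- A nontrivial element of `Γ` moves `v`, and the walk from `v` to its image has a first edge. -/
theorem exists_adj (v : V) : ∃ w, F.graph.Adj v w := by
  obtain ⟨φ⟩ := F.free_rank_two
  have : Nontrivial F.Γ := φ.toEquiv.nontrivial
  obtain ⟨γ, hγ⟩ := exists_ne (1 : F.Γ)
  have hv := F.no_fixed_vertex γ γ.2 (by simpa using hγ) v
  obtain ⟨c⟩ := F.connected.preconnected v ((γ : F.graph ≃g F.graph) v)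
  generalize (γ : F.graph ≃g F.graph) v = w at *
  cases c with
  | nil => exact absurd rfl hv
  | cons h _ => exact ⟨_, h⟩

theorem p_mem_edgeSegment {v : V} {e : Sym2 V} (h : v ∈ e) : F.p v ∈ edgeSegment F.p e :=
  subset_convexHull ℝ _ ⟨v, h, rfl⟩

/-- The non-crossing condition speaks of edges only; it is applied to `e` and some edge at `v`. -/
theorem mem_of_p_mem_edgeSegment {v : V} {e : Sym2 V} (he : e ∈ F.graph.edgeSet)
    (h : F.p v ∈ edgeSegment F.p e) : v ∈ e := by
  obtain ⟨w, hw⟩ := F.exists_adj v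
  by_cases hne : e = s(v, w)
  · simp [hne]
  obtain ⟨x, ⟨hxe, hx⟩, hxv⟩ := F.non_crossing e he s(v, w) hw hne
    ⟨h, F.p_mem_edgeSegment (Sym2.mem_mk_left v w)⟩
  rcases Sym2.mem_iff.1 hx with rfl | rfl
  · exact hxe
  · exact absurd hxv.symm (F.p_ne _ _ hw)

theorem eq_of_mem_openSegment {u v : V} (huv : F.graph.Adj u v) {y : Plane}
    (hy : y ∈ openSegment ℝ (F.p u) (F.p v)) {e : Sym2 V} (he : e ∈ F.graph.edgeSet)
    (hye : y ∈ edgeSegment F.p e) : e = s(u, v) := by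
  by_contra hne
  have hy' : y ∈ edgeSegment F.p s(u, v) := by
    rw [edgeSegment_mk]
    exact openSegment_subset_segment ℝ _ _ hy
  obtain ⟨w, ⟨-, hw⟩, rfl⟩ := F.non_crossing e he _ huv hne ⟨hye, hy'⟩
  rcases Sym2.mem_iff.1 hw with rfl | rfl
  · exact F.p_ne _ _ huv (left_mem_openSegment_iff.1 hy)
  · exact F.p_ne _ _ huv (right_mem_openSegment_iff.1 hy)

theorem notMem_range_of_mem_openSegment {u v : V} (huv : F.graph.Adj u v) {y : Plane}
    (hy : y ∈ openSegment ℝ (F.p u) (F.p v)) : y ∉ range F.p := by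
  rintro ⟨w, rfl⟩
  have hw : w ∈ s(u, v) := F.mem_of_p_mem_edgeSegment huv (by
    rw [edgeSegment_mk]
    exact openSegment_subset_segment ℝ _ _ hy)
  rcases Sym2.mem_iff.1 hw with rfl | rfl
  · exact F.p_ne _ _ huv (left_mem_openSegment_iff.1 hy)
  · exact F.p_ne _ _ huv (right_mem_openSegment_iff.1 hy)

theorem skeleton_eq : F.skeleton = ⋃ e : F.graph.edgeSet, edgeSegment F.p e := by
  ext x
  simp only [skeleton, skeletonOf, mem_union, mem_iUnion, Subtype.exists, exists_prop]
  refine ⟨?_, Or.inr⟩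
  rintro (⟨v, rfl⟩ | h)
  · obtain ⟨w, hw⟩ := F.exists_adj v
    exact ⟨s(v, w), hw, F.p_mem_edgeSegment (Sym2.mem_mk_left v w)⟩
  · exact h

theorem mem_skeleton {x : Plane} :
    x ∈ F.skeleton ↔ ∃ e ∈ F.graph.edgeSet, x ∈ edgeSegment F.p e := by
  simp [skeleton_eq]

theorem finite_Γ_of_isBounded {B : Set Plane} (hB : Bornology.IsBounded B) :
    {γ : F.Γ | F.π (Additive.ofMul γ) ∈ B}.Finite := by
  have := F.discrete
  have hc : IsClosed (F.π.range : Set Plane) := AddSubgroup.isClosed_of_discrete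
  have h : (B ∩ (F.π.range : Set Plane)).Finite :=
    Metric.finite_isBounded_inter_isClosed ⟨F.discrete⟩ hB hc
  refine Set.Finite.of_finite_image (f := fun γ : F.Γ => F.π (Additive.ofMul γ)) (h.subset ?_)
    (fun a _ b _ hab => by simpa using F.π_injective hab)
  rintro _ ⟨γ, hγ, rfl⟩
  exact ⟨hγ, _, rfl⟩

theorem locallyFinite_edges :
    LocallyFinite fun e : F.graph.edgeSet => edgeSegment F.p (e : Sym2 V) := by
  intro x
  refine ⟨ball x 1, ball_mem_nhds x one_pos, ?_⟩
  obtain ⟨S, hS, h⟩ := F.finite_edge_orbits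
  have hD : Bornology.IsBounded (⋃ e ∈ S, edgeSegment F.p e) :=
    (Bornology.isBounded_biUnion hS).2 fun e _ => (isCompact_edgeSegment F.p e).isBounded
  -- An edge meeting the ball is carried into `S` by a translation that lies in the difference of
  -- two bounded sets, so discreteness leaves finitely many.
  have hfin := ((F.finite_Γ_of_isBounded (hD.sub (isBounded_ball (x := x) (r := 1)))).prod hS).image
    (fun a => a.2.map ((a.1⁻¹ : F.Γ) : F.graph ≃g F.graph))
  refine Set.Finite.of_finite_image (f := Subtype.val) (hfin.subset ?_) Subtype.val_injective.injOn
  rintro _ ⟨⟨e, he⟩, ⟨y, hye, hyx⟩, rfl⟩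
  obtain ⟨γ, hγ, heS⟩ := h e he
  refine ⟨(⟨γ, hγ⟩, e.map γ), ⟨?_, heS⟩, ?_⟩
  · refine Set.mem_sub.2 ⟨y + F.π (Additive.ofMul ⟨γ, hγ⟩), ?_, y, hyx, by simp⟩
    exact mem_biUnion heS ((F.edgeSegment_map ⟨γ, hγ⟩ e).symm ▸ ⟨y, hye, rfl⟩)
  · simp only [Sym2.map_map]
    refine (congrArg (fun f => Sym2.map f e) ?_).trans (congrFun Sym2.map_id' e)
    ext v
    simp

theorem isClosed_skeleton : IsClosed F.skeleton := by
  rw [skeleton_eq]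
  exact F.locallyFinite_edges.isClosed_iUnion fun e => (isCompact_edgeSegment F.p e).isClosed

theorem eventually_mem_edgeSegment (x : Plane) :
    ∀ᶠ z in 𝓝 x, ∀ e ∈ F.graph.edgeSet, z ∈ edgeSegment F.p e → x ∈ edgeSegment F.p e := by
  have := F.locallyFinite_edges.iInter_compl_mem_nhds
    (fun e => (isCompact_edgeSegment F.p e).isClosed) x
  filter_upwards [this] with z hz e he hze
  by_contra hx
  exact (mem_iInter₂.1 hz ⟨e, he⟩ hx) hze

/-- Baire's theorem, for countably many closed segments with dense complements. -/
theorem dense_compl_skeleton : Dense F.skeletonᶜ := by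
  have := F.countable_vertices
  have : Countable (Sym2 V) := Quot.mk_surjective.countable
  rw [skeleton_eq, compl_iUnion]
  refine dense_iInter_of_isOpen (fun e => (isCompact_edgeSegment F.p e).isClosed.isOpen_compl) ?_
  rintro ⟨e, -⟩
  induction e with
  | _ a b =>
    rw [edgeSegment_mk]
    exact dense_compl_segment _ _

theorem countable_range_p : (range F.p).Countable := by
  have := F.countable_vertices
  exact countable_range F.p

theorem range_p_subset_skeleton : range F.p ⊆ F.skeleton := subset_union_left

theorem one_lt_rank_plane : 1 < Module.rank ℝ Plane := by
  apply Module.one_lt_rank_of_one_lt_finrank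
  simp

/-- Near an interior point of an edge, the skeleton is on the line of that edge. -/
theorem eventually_mem_skeleton_iff {u v : V} (huv : F.graph.Adj u v) {y : Plane}
    (hy : y ∈ openSegment ℝ (F.p u) (F.p v)) :
    ∀ᶠ z in 𝓝 y, z ∈ F.skeleton ↔ det2 (F.p v - F.p u) (z - F.p u) = 0 := by
  filter_upwards [F.eventually_mem_edgeSegment y, eventually_mem_segment (F.p_ne _ _ huv) hy]
    with z h1 h2
  refine ⟨fun hz => ?_, fun hz => ?_⟩
  · obtain ⟨e, he, hze⟩ := F.mem_skeleton.1 hz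
    rw [F.eq_of_mem_openSegment huv hy he (h1 e he hze), edgeSegment_mk] at hze
    exact det2_eq_zero_of_mem_segment hze
  · exact F.mem_skeleton.2 ⟨s(u, v), huv, by rw [edgeSegment_mk]; exact h2 hz⟩

theorem exists_mem_openSegment {y : Plane} (hy : y ∈ F.skeleton) (hyp : y ∉ range F.p) :
    ∃ u v, F.graph.Adj u v ∧ y ∈ openSegment ℝ (F.p u) (F.p v) := by
  obtain ⟨e, he, hye⟩ := F.mem_skeleton.1 hy
  induction e with
  | _ u v =>
    rw [edgeSegment_mk] at hye
    exact ⟨u, v, he, mem_openSegment_of_ne_left_right (fun h => hyp ⟨u, h⟩)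
      (fun h => hyp ⟨v, h⟩) hye⟩

end PeriodicFramework

namespace PeriodicFramework

open Set Filter Metric

variable {V : Type*} (F : PeriodicFramework V)

/-! ### Faces and tetrads -/

/-- The face containing a point off the skeleton. -/
def faceAt (x : Plane) (hx : x ∉ F.skeleton) : F.Face :=
  ⟨connectedComponentIn F.skeletonᶜ x, x, hx, rfl⟩

theorem mem_faceAt {x : Plane} (hx : x ∉ F.skeleton) : x ∈ (F.faceAt x hx).1 :=
  mem_connectedComponentIn hx

variable {F} in
theorem Face.eq_faceAt {U : F.Face} {x : Plane} (hx : x ∈ U.1) (hxS : x ∉ F.skeleton) :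
    U = F.faceAt x hxS := by
  obtain ⟨U, y, hy, rfl⟩ := U
  exact Subtype.ext (connectedComponentIn_eq hx)

variable {F} in
theorem Face.notMem_skeleton (U : F.Face) {x : Plane} (hx : x ∈ U.1) : x ∉ F.skeleton := by
  obtain ⟨U, y, hy, rfl⟩ := U
  exact connectedComponentIn_subset _ _ hx

variable {F} in
theorem Face.eq_of_mem {U W : F.Face} {x : Plane} (hU : x ∈ U.1) (hW : x ∈ W.1) : U = W :=
  (Face.eq_faceAt hU (U.notMem_skeleton hU)).trans (Face.eq_faceAt hW _).symm

variable {F} in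
theorem Face.isOpen (U : F.Face) : IsOpen U.1 := by
  obtain ⟨U, y, hy, rfl⟩ := U
  exact F.isClosed_skeleton.isOpen_compl.connectedComponentIn

variable {F} in
theorem Face.isPreconnected (U : F.Face) : IsPreconnected U.1 := by
  obtain ⟨U, y, hy, rfl⟩ := U
  exact isPreconnected_connectedComponentIn

variable {F} in
theorem Face.nonempty (U : F.Face) : U.1.Nonempty := by
  obtain ⟨U, y, hy, rfl⟩ := U
  exact ⟨y, mem_connectedComponentIn hy⟩

variable {F} in
theorem Face.subset_of_isPreconnected {U : F.Face} {T : Set Plane} (hT : IsPreconnected T)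
    (hTS : T ⊆ F.skeletonᶜ) {x : Plane} (hxT : x ∈ T) (hxU : x ∈ U.1) : T ⊆ U.1 := by
  rw [Face.eq_faceAt hxU (hTS hxT)]
  exact hT.subset_connectedComponentIn hxT hTS

theorem tendsto_add_smul_perp (y a : Plane) :
    Tendsto (fun ε : ℝ => y + ε • perp a) (𝓝[>] 0) (𝓝 y) := by
  have : Continuous fun ε : ℝ => y + ε • perp a := by fun_prop
  simpa using (this.tendsto 0).mono_left nhdsWithin_le_nhds

theorem tendsto_sub_smul_perp (y a : Plane) :
    Tendsto (fun ε : ℝ => y - ε • perp a) (𝓝[>] 0) (𝓝 y) := by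
  have : Continuous fun ε : ℝ => y - ε • perp a := by fun_prop
  simpa using (this.tendsto 0).mono_left nhdsWithin_le_nhds

theorem det2_add_smul_perp_pos {u v : V} (huv : F.graph.Adj u v) {y : Plane}
    (hy : y ∈ openSegment ℝ (F.p u) (F.p v)) {ε : ℝ} (hε : 0 < ε) :
    0 < det2 (F.p v - F.p u) (y + ε • perp (F.p v - F.p u) - F.p u) := by
  rw [add_sub_right_comm, det2_add_smul_perp,
    det2_eq_zero_of_mem_segment (openSegment_subset_segment ℝ _ _ hy), zero_add]
  exact mul_pos hε (sq_add_sq_pos_of_ne (sub_ne_zero.2 (F.p_ne _ _ huv).symm))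

theorem det2_sub_smul_perp_neg {u v : V} (huv : F.graph.Adj u v) {y : Plane}
    (hy : y ∈ openSegment ℝ (F.p u) (F.p v)) {ε : ℝ} (hε : 0 < ε) :
    det2 (F.p v - F.p u) (y - ε • perp (F.p v - F.p u) - F.p u) < 0 := by
  have h := F.det2_add_smul_perp_pos huv hy hε
  have h0 := det2_eq_zero_of_mem_segment (openSegment_subset_segment ℝ _ _ hy)
  simp only [det2, PiLp.add_apply, PiLp.sub_apply, PiLp.smul_apply, smul_eq_mul] at h h0 ⊢
  linarith

theorem convex_det2_pos (a b : Plane) : Convex ℝ {z | 0 < det2 a (z - b)} := by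
  have h : IsLinearMap ℝ fun z => det2 a z :=
    ⟨fun x y => by simp [det2]; ring, fun c x => by simp [det2]; ring⟩
  have h2 : {z | 0 < det2 a (z - b)} = {z | det2 a b < det2 a z} := by
    ext z
    simp only [mem_ofPred_eq, h.map_sub, sub_pos]
  rw [h2]
  exact convex_halfSpace_gt h _

/-- A small half-disc on the left of the edge is convex and misses the skeleton. -/
theorem exists_left_face_at {u v : V} (huv : F.graph.Adj u v) {y : Plane}
    (hy : y ∈ openSegment ℝ (F.p u) (F.p v)) :
    ∃ W : F.Face, ∀ᶠ z in 𝓝 y, 0 < det2 (F.p v - F.p u) (z - F.p u) → z ∈ W.1 := by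
  obtain ⟨r, hr, h⟩ := Metric.eventually_nhds_iff_ball.1 (F.eventually_mem_skeleton_iff huv hy)
  obtain ⟨ε, hεr, hε⟩ := (((tendsto_add_smul_perp y (F.p v - F.p u)).eventually (ball_mem_nhds y hr)).and
    self_mem_nhdsWithin).exists
  have hpos := F.det2_add_smul_perp_pos huv hy hε
  refine ⟨F.faceAt _ fun hS => hpos.ne' ((h _ hεr).1 hS), ?_⟩
  filter_upwards [ball_mem_nhds y hr] with z hz hzpos
  refine Face.subset_of_isPreconnected
    ((convex_ball y r).inter (convex_det2_pos (F.p v - F.p u) (F.p u))).isPreconnected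
    (fun w hw hwS => hw.2.ne' ((h w hw.1).1 hwS)) ⟨hεr, hpos⟩ (F.mem_faceAt _) ⟨hz, hzpos⟩

/-- The left face at a point is locally constant along the open edge, because neighbouring
half-discs overlap. -/
theorem exists_left_face {u v : V} (huv : F.graph.Adj u v) :
    ∃ W : F.Face, ∀ y ∈ openSegment ℝ (F.p u) (F.p v),
      ∀ᶠ z in 𝓝 y, 0 < det2 (F.p v - F.p u) (z - F.p u) → z ∈ W.1 := by
  have : Nonempty F.Face := ⟨F.faceAt _ F.dense_compl_skeleton.nonempty.choose_spec⟩
  choose! W hW using fun y => F.exists_left_face_at huv (y := y)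
  let γ : ℝ → Plane := fun t => F.p u + t • (F.p v - F.p u)
  have hγ : Continuous γ := by fun_prop
  have hγm : ∀ t ∈ Ioo (0 : ℝ) 1, γ t ∈ openSegment ℝ (F.p u) (F.p v) := fun t ht => by
    rw [openSegment_eq_image']
    exact ⟨t, ht, rfl⟩
  have hloc : ∀ t ∈ Ioo (0 : ℝ) 1, ConstNear ∅ (fun t => W (γ t)) t := by
    intro t ht
    refine ⟨W (γ t), nhdsWithin_le_nhds ?_⟩
    have h1 := hγ.continuousAt.eventually (eventually_eventually_nhds.2 (hW _ (hγm t ht)))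
    filter_upwards [h1, isOpen_Ioo.mem_nhds ht] with t' ht' hmem
    have h2 := (tendsto_add_smul_perp (γ t') (F.p v - F.p u)).eventually (ht'.and (hW _ (hγm t' hmem)))
    obtain ⟨ε, hε, hpos⟩ := (h2.and self_mem_nhdsWithin).exists
    have hp := F.det2_add_smul_perp_pos huv (hγm t' hmem) hpos
    exact Face.eq_of_mem (hε.2 hp) (hε.1 hp)
  have hhalf : (1 / 2 : ℝ) ∈ Ioo (0 : ℝ) 1 := by norm_num
  refine ⟨W (γ (1 / 2)), fun y hy => ?_⟩
  have h3 := hy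
  rw [openSegment_eq_image'] at h3
  obtain ⟨t, ht, rfl⟩ := h3
  have h4 : W (γ t) = W (γ (1 / 2)) := isPreconnected_Ioo.eq_of_constNear (S := ∅) (by simp) hloc
    ht (by simp) hhalf (by simp)
  rw [← h4]
  exact hW _ hy

theorem exists_right_face {u v : V} (huv : F.graph.Adj u v) :
    ∃ W : F.Face, ∀ y ∈ openSegment ℝ (F.p u) (F.p v),
      ∀ᶠ z in 𝓝 y, det2 (F.p v - F.p u) (z - F.p u) < 0 → z ∈ W.1 := by
  obtain ⟨W, hW⟩ := F.exists_left_face huv.symm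
  refine ⟨W, fun y hy => ?_⟩
  filter_upwards [hW y (openSegment_symm ℝ (F.p u) (F.p v) ▸ hy)] with z hz hneg
  refine hz ?_
  rw [det2_swap]
  linarith

theorem isTetrad_of_eventually {u v : V} (huv : F.graph.Adj u v) {U W : F.Face}
    (h : ∀ y ∈ openSegment ℝ (F.p u) (F.p v), ∀ᶠ z in 𝓝 y,
      (0 < det2 (F.p v - F.p u) (z - F.p u) → z ∈ W.1) ∧
      (det2 (F.p v - F.p u) (z - F.p u) < 0 → z ∈ U.1)) : F.IsTetrad u v U W := by
  refine ⟨huv, fun y hy => ?_⟩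
  filter_upwards [tendsto_add_smul_perp y (F.p v - F.p u) (h y hy),
    tendsto_sub_smul_perp y (F.p v - F.p u) (h y hy), self_mem_nhdsWithin] with ε h1 h2 hε
  exact ⟨h1.1 (F.det2_add_smul_perp_pos huv hy hε), h2.2 (F.det2_sub_smul_perp_neg huv hy hε)⟩

theorem exists_isTetrad {u v : V} (huv : F.graph.Adj u v) : ∃ U W, F.IsTetrad u v U W := by
  obtain ⟨W, hW⟩ := F.exists_left_face huv
  obtain ⟨U, hU⟩ := F.exists_right_face huv
  exact ⟨U, W, F.isTetrad_of_eventually huv fun y hy => (hW y hy).and (hU y hy)⟩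

variable {F}

/-- Tetrads are defined by testing along normals only; this upgrades the test to
half-neighbourhoods, using the left and right faces already found. -/
theorem IsTetrad.eventually {u v : V} {U W : F.Face} (h : F.IsTetrad u v U W) {y : Plane}
    (hy : y ∈ openSegment ℝ (F.p u) (F.p v)) : ∀ᶠ z in 𝓝 y,
      (0 < det2 (F.p v - F.p u) (z - F.p u) → z ∈ W.1) ∧
      (det2 (F.p v - F.p u) (z - F.p u) < 0 → z ∈ U.1) := by
  obtain ⟨W', hW⟩ := F.exists_left_face h.1
  obtain ⟨U', hU⟩ := F.exists_right_face h.1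
  obtain ⟨ε, ⟨⟨h1, h2⟩, h3⟩, hε⟩ := (((h.2 y hy).and
    (tendsto_add_smul_perp y (F.p v - F.p u) (hW y hy))).and
    (tendsto_sub_smul_perp y (F.p v - F.p u) (hU y hy))).and self_mem_nhdsWithin |>.exists
  have hWW : W' = W := Face.eq_of_mem (h2 (F.det2_add_smul_perp_pos h.1 hy hε)) h1.1
  have hUU : U' = U := Face.eq_of_mem (h3 (F.det2_sub_smul_perp_neg h.1 hy hε)) h1.2
  rw [← hWW, ← hUU]
  exact (hW y hy).and (hU y hy)

theorem IsTetrad.symm {u v : V} {U W : F.Face} (h : F.IsTetrad u v U W) :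
    F.IsTetrad v u W U := by
  refine F.isTetrad_of_eventually h.1.symm fun y hy => ?_
  filter_upwards [h.eventually (openSegment_symm ℝ (F.p u) (F.p v) ▸ hy)] with z hz
  rw [det2_swap, neg_pos, neg_lt_zero]
  exact hz.symm

theorem mem_translate {U : F.Face} {l : F.lattice} {x : Plane} :
    x ∈ (F.translate U l).1 ↔ x - l ∈ U.1 := by
  constructor
  · rintro ⟨y, hy, rfl⟩
    simpa using hy
  · intro h
    exact ⟨_, h, by simp⟩

/-- Translation of tetrads by periods. -/
theorem IsTetrad.translate {u v : V} {U W : F.Face} (h : F.IsTetrad u v U W) (γ : F.Γ)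
    (l : F.lattice) (hl : (l : Plane) = F.π (Additive.ofMul γ)) :
    F.IsTetrad ((γ : F.graph ≃g F.graph) u) ((γ : F.graph ≃g F.graph) v)
      (F.translate U l) (F.translate W l) := by
  refine ⟨(γ : F.graph ≃g F.graph).map_rel_iff.2 h.1, ?_⟩
  intro y hy
  rw [F.p_smul, F.p_smul, ← hl] at hy ⊢
  have hy' : y - l ∈ openSegment ℝ (F.p u) (F.p v) := by
    rw [openSegment_eq_image'] at hy ⊢
    obtain ⟨t, ht, rfl⟩ := hy
    refine ⟨t, ht, ?_⟩
    simp only [add_sub_add_right_eq_sub]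
    abel
  filter_upwards [h.2 _ hy'] with ε hε
  rw [add_sub_add_right_eq_sub]
  rw [mem_translate, mem_translate, add_sub_right_comm, sub_right_comm]
  exact hε

theorem translate_translate (U : F.Face) (l m : F.lattice) :
    F.translate (F.translate U l) m = F.translate U (l + m) := by
  apply Subtype.ext
  ext x
  rw [mem_translate, mem_translate, mem_translate, AddSubgroup.coe_add]
  rw [sub_sub, add_comm (m : Plane)]

theorem translate_zero (U : F.Face) : F.translate U 0 = U := by
  apply Subtype.ext
  ext x
  simp [mem_translate]

/-! ### Functions with prescribed jumps across the edges -/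

variable (F) in
/-- `f` is constant on each face near `y`, and jumps by `j u v` from right to left across an open
edge `(u, v)` through `y`. -/
def HasJumpsAt {M : Type*} [Add M] (j : V → V → M) (f : Plane → M) (y : Plane) : Prop :=
  (y ∉ F.skeleton → ConstNear F.skeleton f y) ∧
  ∀ u v, F.graph.Adj u v → y ∈ openSegment ℝ (F.p u) (F.p v) → ∃ a, ∀ᶠ z in 𝓝[F.skeletonᶜ] y,
    (0 < det2 (F.p v - F.p u) (z - F.p u) → f z = a + j u v) ∧
    (det2 (F.p v - F.p u) (z - F.p u) < 0 → f z = a)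

theorem HasJumpsAt.congr {M : Type*} [Add M] {j : V → V → M} {f g : Plane → M} {y : Plane}
    (hfg : f =ᶠ[𝓝[F.skeletonᶜ] y] g) (hf : F.HasJumpsAt j f y) : F.HasJumpsAt j g y := by
  refine ⟨fun hy => ?_, fun u v huv hy => ?_⟩
  · obtain ⟨a, ha⟩ := hf.1 hy
    refine ⟨a, ?_⟩
    filter_upwards [ha, hfg] with z h1 h2
    rw [← h2, h1]
  · obtain ⟨a, ha⟩ := hf.2 u v huv hy
    refine ⟨a, ?_⟩
    filter_upwards [ha, hfg] with z h1 h2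
    rwa [← h2]

theorem HasJumpsAt.map {M N : Type*} [AddCommGroup M] [AddCommGroup N] {j : V → V → M}
    {f : Plane → M} {y : Plane} (hf : F.HasJumpsAt j f y) (φ : M →+ N) (c : N) :
    F.HasJumpsAt (fun u v => φ (j u v)) (fun z => φ (f z) + c) y := by
  refine ⟨fun hy => ?_, fun u v huv hy => ?_⟩
  · obtain ⟨a, ha⟩ := hf.1 hy
    refine ⟨φ a + c, ?_⟩
    filter_upwards [ha] with z h1
    rw [h1]
  · obtain ⟨a, ha⟩ := hf.2 u v huv hy
    refine ⟨φ a + c, ?_⟩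
    filter_upwards [ha] with z h1
    refine ⟨fun h => ?_, fun h => ?_⟩
    · rw [h1.1 h, map_add]
      abel
    · rw [h1.2 h]

theorem HasJumpsAt.sub {M : Type*} [AddCommGroup M] {j : V → V → M} {f g : Plane → M} {y : Plane}
    (hf : F.HasJumpsAt j f y) (hg : F.HasJumpsAt j g y) :
    F.HasJumpsAt (fun _ _ => 0) (fun z => f z - g z) y := by
  refine ⟨fun hy => ?_, fun u v huv hy => ?_⟩
  · obtain ⟨a, ha⟩ := hf.1 hy
    obtain ⟨b, hb⟩ := hg.1 hy
    refine ⟨a - b, ?_⟩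
    filter_upwards [ha, hb] with z h1 h2
    rw [h1, h2]
  · obtain ⟨a, ha⟩ := hf.2 u v huv hy
    obtain ⟨b, hb⟩ := hg.2 u v huv hy
    refine ⟨a - b, ?_⟩
    filter_upwards [ha, hb] with z h1 h2
    refine ⟨fun h => ?_, fun h => ?_⟩
    · rw [h1.1 h, h2.1 h]
      abel
    · rw [h1.2 h, h2.2 h]

theorem HasJumpsAt.constNear {M : Type*} [AddCommGroup M] {j : V → V → M} {f : Plane → M}
    {y : Plane} (hf : F.HasJumpsAt j f y) (hyp : y ∉ range F.p)
    (hj : ∀ u v, F.graph.Adj u v → y ∈ openSegment ℝ (F.p u) (F.p v) → j u v = 0) :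
    ConstNear F.skeleton f y := by
  by_cases hy : y ∈ F.skeleton
  swap
  · exact hf.1 hy
  obtain ⟨u, v, huv, hyo⟩ := F.exists_mem_openSegment hy hyp
  obtain ⟨a, ha⟩ := hf.2 u v huv hyo
  refine ⟨a, ?_⟩
  filter_upwards [ha, self_mem_nhdsWithin,
    nhdsWithin_le_nhds (F.eventually_mem_skeleton_iff huv hyo)] with z h1 hz h2
  rcases lt_trichotomy (det2 (F.p v - F.p u) (z - F.p u)) 0 with h | h | h
  · exact h1.2 h
  · exact absurd (h2.2 h) hz
  · rw [h1.1 h, hj u v huv hyo, add_zero]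

/-- Edges with zero jump are invisible, and vertices are removable, so nothing is required of `f` at
them. -/
theorem constNear_of_hasJumpsAt {M : Type*} [AddCommGroup M] {j : V → V → M} {f : Plane → M}
    {O : Set Plane} (hO : IsOpen O) (hf : ∀ y ∈ O, y ∉ range F.p → F.HasJumpsAt j f y)
    (hj : ∀ y ∈ O, ∀ u v, F.graph.Adj u v → y ∈ openSegment ℝ (F.p u) (F.p v) → j u v = 0)
    {x : Plane} (hx : x ∈ O) : ConstNear F.skeleton f x :=
  constNear_of_diff_countable one_lt_rank_plane F.dense_compl_skeleton F.countable_range_p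
    F.range_p_subset_skeleton hO (fun y hy hyp => (hf y hy hyp).constNear hyp (hj y hy)) hx

/-! ### Connectedness of the dual graph -/

/-- The indicator function of the faces reachable from `U` does not jump across any edge, since
tetrads can be reversed; hence it is constant off the skeleton. -/
theorem nonempty_facePath (U W : F.Face) : Nonempty (F.FacePath U W) := by
  classical
  have hcomp : ∀ {A B C : F.Face}, F.FacePath A B → F.FacePath B C →
      Nonempty (F.FacePath A C) := by
    intro A B C P
    induction P with
    | nil => exact fun Q => ⟨Q⟩
    | cons u v h P ih =>
      intro Q
      obtain ⟨R⟩ := ih Q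
      exact ⟨.cons u v h R⟩
  let f : Plane → ℝ := fun z =>
    if ∃ A : F.Face, z ∈ A.1 ∧ Nonempty (F.FacePath U A) then 1 else 0
  have hf : ∀ {A : F.Face} {z}, z ∈ A.1 → f z = if Nonempty (F.FacePath U A) then 1 else 0 := by
    intro A z hz
    have : (∃ B : F.Face, z ∈ B.1 ∧ Nonempty (F.FacePath U B)) ↔ Nonempty (F.FacePath U A) :=
      ⟨fun ⟨B, hB, h⟩ => Face.eq_of_mem hB hz ▸ h, fun h => ⟨A, hz, h⟩⟩
    simp only [f, this]
  have hjump : ∀ y, F.HasJumpsAt (fun _ _ => (0 : ℝ)) f y := by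
    refine fun y => ⟨fun hy => ?_, fun u v huv hy => ?_⟩
    · refine ⟨if Nonempty (F.FacePath U (F.faceAt y hy)) then 1 else 0, ?_⟩
      filter_upwards [nhdsWithin_le_nhds ((F.faceAt y hy).isOpen.mem_nhds (F.mem_faceAt hy))]
        with z hz using hf hz
    · obtain ⟨A, B, hT⟩ := F.exists_isTetrad huv
      have hAB : Nonempty (F.FacePath U A) ↔ Nonempty (F.FacePath U B) :=
        ⟨fun ⟨P⟩ => hcomp P (.cons u v hT (.nil B)),
          fun ⟨P⟩ => hcomp P (.cons v u hT.symm (.nil A))⟩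
      refine ⟨if Nonempty (F.FacePath U A) then 1 else 0, nhdsWithin_le_nhds ?_⟩
      filter_upwards [hT.eventually hy] with z hz
      refine ⟨fun h => ?_, fun h => hf (hz.2 h)⟩
      rw [hf (hz.1 h), add_zero]
      simp only [hAB]
  obtain ⟨x, hx⟩ := U.nonempty
  obtain ⟨w, hw⟩ := W.nonempty
  have h := (isPreconnected_univ (α := Plane)).eq_of_constNear F.dense_compl_skeleton (f := f)
    (fun y _ => constNear_of_hasJumpsAt isOpen_univ (fun y _ _ => hjump y)
      (fun _ _ _ _ _ _ => rfl) (mem_univ y))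
    (mem_univ x) (U.notMem_skeleton hx) (mem_univ w) (W.notMem_skeleton hw)
  rw [hf hx, hf hw, if_pos ⟨.nil U⟩] at h
  by_contra hn
  rw [if_neg hn] at h
  exact one_ne_zero h

/-- A function of the faces is determined up to a constant by its differences along tetrads. -/
theorem sub_eq_sub_of_tetrads {M : Type*} [AddCommGroup M] {g h : F.Face → M}
    (hgh : ∀ u v U W, F.IsTetrad u v U W → g W - g U = h W - h U) (U W : F.Face) :
    g W - g U = h W - h U := by
  obtain ⟨P⟩ := nonempty_facePath U W
  induction P with
  | nil => simp
  | cons u v hT P ih =>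
    rw [← sub_add_sub_cancel (g _), ih, hgh _ _ _ _ hT, sub_add_sub_cancel]

end PeriodicFramework

/-! ### Arguments near a ray -/

section Arg

open Set Filter Metric

/-- Away from its cut, each branch changes by `arg (ζ / w)`, whatever `c` is. A combination of
branches whose weights sum to zero is therefore locally constant off the cuts. -/
theorem eventually_arg_neg_div {w c : ℂ} (hw : w ≠ 0) (hc : c ≠ 0)
    (h : -(w / c) ∈ Complex.slitPlane) :
    ∀ᶠ ζ in 𝓝 w, Complex.arg (-(ζ / c)) = Complex.arg (-(w / c)) + Complex.arg (ζ / w) := by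
  have h1 : Tendsto (fun ζ : ℂ => Complex.arg (-(w / c)) + Complex.arg (ζ / w)) (𝓝 w)
      (𝓝 (Complex.arg (-(w / c)) + 0)) := by
    refine tendsto_const_nhds.add ?_
    have h2 : ContinuousAt (fun ζ : ℂ => Complex.arg (ζ / w)) w := by
      refine ContinuousAt.comp (f := fun ζ : ℂ => ζ / w) (Complex.continuousAt_arg ?_) (by fun_prop)
      simp [div_self hw]
    simpa [ContinuousAt, div_self hw] using h2
  have h3 : Complex.arg (-(w / c)) + 0 ∈ Ioo (-Real.pi) Real.pi := by
    rw [add_zero]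
    exact ⟨Complex.neg_pi_lt_arg _,
      lt_of_le_of_ne (Complex.arg_le_pi _) (Complex.mem_slitPlane_iff_arg.1 h).1⟩
  filter_upwards [h1 (isOpen_Ioo.mem_nhds h3), isOpen_ne.mem_nhds hw] with ζ hζ hζ0
  rw [← Complex.arg_mul (neg_ne_zero.2 (div_ne_zero hw hc)) (div_ne_zero hζ0 hw)
    ⟨hζ.1, hζ.2.le⟩]
  congr 1
  field_simp

theorem arg_neg_div_eq_of_eq_mul {w c ζ : ℂ} {r : ℝ} (hr : 0 < r) (hw : w = r * c) :
    Complex.arg (-(ζ / c)) = Complex.arg (-(ζ / w)) := by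
  have : -(ζ / c) = r * -(ζ / w) := by
    have : (r : ℂ) ≠ 0 := by exact_mod_cast hr.ne'
    rw [hw]
    field_simp
  rw [this, Complex.arg_real_mul _ hr]

/-- The sign in `arg (-(w / c))` places the cut on the ray through `c`. -/
theorem exists_eq_mul_of_notMem_slitPlane {w c : ℂ} (hw : w ≠ 0) (hc : c ≠ 0)
    (h : -(w / c) ∉ Complex.slitPlane) : ∃ r : ℝ, 0 < r ∧ w = r * c := by
  rw [Complex.mem_slitPlane_iff, not_or, not_not, Complex.neg_re, Complex.neg_im, neg_pos, not_lt,
    neg_eq_zero] at h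
  have h1 : w / c = ((w / c).re : ℂ) := Complex.ext rfl (by simpa using h.2)
  refine ⟨(w / c).re, lt_of_le_of_ne h.1 fun h0 => ?_, ?_⟩
  · rw [← h0] at h1
    exact div_ne_zero hw hc (by simpa using h1)
  · rw [← h1, div_mul_cancel₀ _ hc]

/-- The plane as the complex numbers. -/
def Plane.toComplex (a : Plane) : ℂ := ⟨a 0, a 1⟩

theorem Plane.continuous_toComplex : Continuous Plane.toComplex := by
  have : Plane.toComplex = fun a => Complex.equivRealProdCLM.symm (a 0, a 1) := by
    ext a
    rfl
  rw [this]
  fun_prop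

theorem Plane.toComplex_ne_zero {a : Plane} (h : a ≠ 0) : a.toComplex ≠ 0 := by
  intro h0
  exact h (Plane.ext' (congrArg Complex.re h0) (congrArg Complex.im h0))

theorem Plane.eq_smul_of_toComplex {a b : Plane} {r : ℝ} (h : a.toComplex = r * b.toComplex) :
    a = r • b := by
  refine Plane.ext' ?_ ?_
  · simpa [Plane.toComplex] using congrArg Complex.re h
  · simpa [Plane.toComplex] using congrArg Complex.im h

theorem Plane.toComplex_div_im (a b : Plane) :
    (a.toComplex / b.toComplex).im = det2 b a / Complex.normSq b.toComplex := by
  rw [Complex.div_im]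
  simp only [Plane.toComplex, det2]
  ring

end Arg

namespace PeriodicFramework

open Set Filter Metric

variable {V : Type*} {F : PeriodicFramework V}

/-! ### Local and global functions with prescribed jumps -/

section Jumps

variable {M : Type*} [NormedAddCommGroup M] {j : V → V → M}

variable (F) in
/-- Near `x`, the function `f` has the jumps `j` and is bounded. -/
def LocalSolution (j : V → V → M) (f : Plane → M) (x : Plane) : Prop :=
  (∀ᶠ y in 𝓝 x, F.HasJumpsAt j f y) ∧ ∃ R : ℝ, ∀ᶠ y in 𝓝[F.skeletonᶜ] x, ‖f y‖ ≤ R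

/-- The condition of `HasJumpsAt` at one oriented edge may be checked at the opposite one. -/
theorem exists_jump_symm {f : Plane → M} {y : Plane} {u v : V} (hj : j v u = -j u v)
    (h : ∃ a, ∀ᶠ z in 𝓝[F.skeletonᶜ] y,
      (0 < det2 (F.p v - F.p u) (z - F.p u) → f z = a + j u v) ∧
      (det2 (F.p v - F.p u) (z - F.p u) < 0 → f z = a)) :
    ∃ a, ∀ᶠ z in 𝓝[F.skeletonᶜ] y,
      (0 < det2 (F.p u - F.p v) (z - F.p v) → f z = a + j v u) ∧
      (det2 (F.p u - F.p v) (z - F.p v) < 0 → f z = a) := by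
  obtain ⟨a, ha⟩ := h
  refine ⟨a + j u v, ?_⟩
  filter_upwards [ha] with z hz
  rw [det2_swap, neg_pos, neg_lt_zero, hj, add_neg_cancel_right]
  exact hz.symm

theorem exists_localSolution_off_skeleton {x : Plane} (hx : x ∉ F.skeleton) :
    ∃ f, F.LocalSolution j f x := by
  refine ⟨fun _ => 0, ?_, 0, by simp⟩
  filter_upwards [F.isClosed_skeleton.isOpen_compl.mem_nhds hx] with y hy
  refine ⟨fun _ => ⟨0, by simp⟩, fun u v huv hyo => absurd ?_ hy⟩
  exact F.mem_skeleton.2 ⟨s(u, v), huv, by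
    rw [edgeSegment_mk]
    exact openSegment_subset_segment ℝ _ _ hyo⟩

theorem exists_localSolution_openSegment (hanti : ∀ u v, F.graph.Adj u v → j v u = -j u v)
    {x : Plane} {u v : V} (huv : F.graph.Adj u v) (hx : x ∈ openSegment ℝ (F.p u) (F.p v)) :
    ∃ f, F.LocalSolution j f x := by
  classical
  let f : Plane → M := fun z => if 0 < det2 (F.p v - F.p u) (z - F.p u) then j u v else 0
  have hc := continuous_det2_sub (F.p v - F.p u) (F.p u)
  refine ⟨f, ?_, ‖j u v‖, ?_⟩
  · filter_upwards [F.eventually_mem_edgeSegment x, F.eventually_mem_skeleton_iff huv hx]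
      with y h1 h2
    refine ⟨fun hyS => ?_, fun u' v' huv' hy => ?_⟩
    · rw [h2] at hyS
      rcases lt_or_gt_of_ne hyS with h | h
      · refine ⟨0, nhdsWithin_le_nhds ?_⟩
        filter_upwards [(isOpen_Iio.preimage hc).mem_nhds h] with z hz
        exact if_neg (not_lt.2 (le_of_lt hz))
      · refine ⟨j u v, nhdsWithin_le_nhds ?_⟩
        filter_upwards [(isOpen_Ioi.preimage hc).mem_nhds h] with z hz
        exact if_pos hz
    · have hmem : y ∈ edgeSegment F.p s(u', v') := by
        rw [edgeSegment_mk]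
        exact openSegment_subset_segment ℝ _ _ hy
      have he := F.eq_of_mem_openSegment huv hx (e := s(u', v')) huv' (h1 _ huv' hmem)
      have hmain : ∃ a, ∀ᶠ z in 𝓝[F.skeletonᶜ] y,
          (0 < det2 (F.p v - F.p u) (z - F.p u) → f z = a + j u v) ∧
          (det2 (F.p v - F.p u) (z - F.p u) < 0 → f z = a) :=
        ⟨0, Eventually.of_forall fun z =>
          ⟨fun h => by rw [zero_add]; exact if_pos h, fun h => if_neg (not_lt.2 h.le)⟩⟩
      rcases Sym2.eq_iff.1 he with ⟨rfl, rfl⟩ | ⟨rfl, rfl⟩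
      · exact hmain
      · exact exists_jump_symm (hanti _ _ huv) hmain
  · refine Eventually.of_forall fun z => ?_
    simp only [f]
    split_ifs <;> simp

theorem LocalSolution.congr {f g : Plane → M} {x : Plane} (hfg : f =ᶠ[𝓝[F.skeletonᶜ] x] g)
    (hf : F.LocalSolution j f x) : F.LocalSolution j g x := by
  obtain ⟨h1, R, hR⟩ := hf
  refine ⟨?_, R, ?_⟩
  · filter_upwards [h1, eventually_eventually_nhds.2 (eventually_nhdsWithin_iff.1 hfg)] with y hy h
    exact hy.congr (eventually_nhdsWithin_iff.2 h)
  · filter_upwards [hfg, hR] with y h1 h2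
    rwa [← h1]

theorem LocalSolution.eventually {f : Plane → M} {x : Plane} (hf : F.LocalSolution j f x) :
    ∀ᶠ y in 𝓝 x, F.LocalSolution j f y := by
  obtain ⟨h1, R, hR⟩ := hf
  filter_upwards [eventually_eventually_nhds.2 h1,
    eventually_eventually_nhds.2 (eventually_nhdsWithin_iff.1 hR)] with y h2 h3
  exact ⟨h2, R, eventually_nhdsWithin_iff.2 h3⟩

theorem LocalSolution.add_const {f : Plane → M} {x : Plane} (hf : F.LocalSolution j f x) (c : M) :
    F.LocalSolution j (fun z => f z + c) x := by
  obtain ⟨h1, R, hR⟩ := hf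
  refine ⟨?_, R + ‖c‖, ?_⟩
  · filter_upwards [h1] with y hy
    exact hy.map (AddMonoidHom.id M) c
  · filter_upwards [hR] with y hy
    exact (norm_add_le _ _).trans (by gcongr)

theorem mem_openSegment_of_eq_smul {a b y : Plane} {r : ℝ} (hr : 0 < r) (hr1 : r < 1)
    (h : y - a = r • (b - a)) : y ∈ openSegment ℝ a b := by
  rw [openSegment_eq_image']
  exact ⟨r, ⟨hr, hr1⟩, (eq_add_of_sub_eq' h).symm⟩

variable [NormedSpace ℝ M]

/-- Each branch `arg (-(ζ / c v))` has its cut along the edge to `v` and drops by `2π` from right to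
left there. Weighting it by `-j w v / (2π)` gives the jump `j w v`, and the zero sum of the weights
removes all other variation. -/
theorem exists_localSolution_vertex (hanti : ∀ u v, F.graph.Adj u v → j v u = -j u v)
    (w : V) (hsum : ∑ v ∈ (F.finite_degree w).toFinset, j w v = 0) :
    ∃ f, F.LocalSolution j f (F.p w) := by
  classical
  let N := (F.finite_degree w).toFinset
  have hN : ∀ {v}, v ∈ N ↔ F.graph.Adj w v := by simp [N]
  let c : V → ℂ := fun v => (F.p v - F.p w).toComplex
  have hc0 : ∀ v ∈ N, c v ≠ 0 := fun v hv =>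
    Plane.toComplex_ne_zero (sub_ne_zero.2 (F.p_ne _ _ (hN.1 hv)).symm)
  let ζ : Plane → ℂ := fun z => (z - F.p w).toComplex
  have hζ : Continuous ζ := Plane.continuous_toComplex.comp (by fun_prop)
  let f : Plane → M := fun z =>
    -(1 / (2 * Real.pi)) • ∑ v ∈ N, Complex.arg (-(ζ z / c v)) • j w v
  have hsum' : ∑ v ∈ N, j w v = 0 := hsum
  refine ⟨f, ?_, ‖-(1 / (2 * Real.pi))‖ * ∑ v ∈ N, Real.pi * ‖j w v‖, ?_⟩
  swap
  · refine Eventually.of_forall fun z => ?_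
    simp only [f, norm_smul]
    gcongr
    refine (norm_sum_le _ _).trans (Finset.sum_le_sum fun v _ => ?_)
    rw [norm_smul, Real.norm_eq_abs]
    gcongr
    exact Complex.abs_arg_le_pi _
  -- Near the vertex, a point on a cut has not passed the far end of the edge, so it lies on the
  -- edge itself.
  have hshort : ∀ᶠ y in 𝓝 (F.p w), ∀ v ∈ N, ∀ r : ℝ, 0 < r → ζ y = r * c v → r < 1 := by
    refine (eventually_all_finset N).2 fun v hv => ?_
    have h0 : ζ (F.p w) = 0 := by simp [ζ, Plane.toComplex]; rfl
    have : ∀ᶠ y in 𝓝 (F.p w), ‖ζ y‖ < ‖c v‖ :=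
      hζ.norm.continuousAt.eventually_lt continuousAt_const
        (by simpa [h0] using hc0 v hv)
    filter_upwards [this] with y hy r hr hyr
    rw [hyr, norm_mul, Complex.norm_real, Real.norm_of_nonneg hr.le] at hy
    by_contra h
    nlinarith [norm_nonneg (c v)]
  filter_upwards [F.eventually_mem_edgeSegment (F.p w), hshort] with y hnear hy
  rcases eq_or_ne y (F.p w) with rfl | hyw
  · refine ⟨fun h => absurd (F.range_p_subset_skeleton ⟨w, rfl⟩) h, fun u v huv h => ?_⟩
    exact absurd ⟨w, rfl⟩ (F.notMem_range_of_mem_openSegment huv h)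
  have hζ0 : ζ y ≠ 0 := Plane.toComplex_ne_zero (sub_ne_zero.2 hyw)
  have hseg : ∀ v ∈ N, -(ζ y / c v) ∉ Complex.slitPlane →
      y ∈ openSegment ℝ (F.p w) (F.p v) := by
    intro v hv h
    obtain ⟨r, hr, hrc⟩ := exists_eq_mul_of_notMem_slitPlane hζ0 (hc0 v hv) h
    exact mem_openSegment_of_eq_smul hr (hy v hv r hr hrc) (Plane.eq_smul_of_toComplex hrc)
  have hstep : ∀ v ∈ N, -(ζ y / c v) ∈ Complex.slitPlane → ∀ᶠ z in 𝓝 y,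
      Complex.arg (-(ζ z / c v)) = Complex.arg (-(ζ y / c v)) + Complex.arg (ζ z / ζ y) :=
    fun v hv h => hζ.continuousAt.eventually (eventually_arg_neg_div hζ0 (hc0 v hv) h)
  have hray : ∀ v, F.graph.Adj w v → y ∈ openSegment ℝ (F.p w) (F.p v) →
      ∃ a, ∀ᶠ z in 𝓝[F.skeletonᶜ] y,
        (0 < det2 (F.p v - F.p w) (z - F.p w) → f z = a + j w v) ∧
        (det2 (F.p v - F.p w) (z - F.p w) < 0 → f z = a) := by
    intro v hv hyo
    have hvN := hN.2 hv
    have hother : ∀ v' ∈ N.erase v, -(ζ y / c v') ∈ Complex.slitPlane := by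
      intro v' hv'
      by_contra h
      have h1 := openSegment_subset_segment ℝ _ _ (hseg v' (Finset.mem_of_mem_erase hv') h)
      rw [← edgeSegment_mk] at h1
      have h2 := F.eq_of_mem_openSegment hv hyo (e := s(w, v'))
        (hN.1 (Finset.mem_of_mem_erase hv')) h1
      exact Finset.ne_of_mem_erase hv' (Sym2.congr_right.1 h2)
    obtain ⟨r, hr, hyr⟩ : ∃ r : ℝ, 0 < r ∧ y - F.p w = r • (F.p v - F.p w) := by
      rw [openSegment_eq_image'] at hyo
      obtain ⟨r, hr, rfl⟩ := hyo
      exact ⟨r, hr.1, add_sub_cancel_left _ _⟩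
    have hcut : ∀ z, Complex.arg (-(ζ z / c v)) = Complex.arg (-(ζ z / ζ y)) := by
      intro z
      refine arg_neg_div_eq_of_eq_mul hr ?_
      simp only [ζ, c, hyr]
      apply Complex.ext <;> simp [Plane.toComplex]
    have him : ∀ z, (ζ z / ζ y).im =
        r * det2 (F.p v - F.p w) (z - F.p w) / Complex.normSq (ζ y) := by
      intro z
      rw [Plane.toComplex_div_im]
      congr 1
      rw [hyr]
      simp [det2]
      ring
    have hnsq : 0 < Complex.normSq (ζ y) := Complex.normSq_pos.2 hζ0
    have hsum1 : ∑ v' ∈ N.erase v, j w v' = -j w v := by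
      rw [← Finset.add_sum_erase N _ hvN] at hsum'
      exact eq_neg_of_add_eq_zero_right hsum'
    set b := ∑ v' ∈ N.erase v, Complex.arg (-(ζ y / c v')) • j w v' with hb
    -- The other weights sum to `-j w v`, so the common increment `arg (ζ z / ζ y)` cancels and only
    -- the offset `ε` remains: `-π` on the left of the edge, `π` on the right.
    have hform : ∀ z, (∀ v' ∈ N.erase v, Complex.arg (-(ζ z / c v')) =
        Complex.arg (-(ζ y / c v')) + Complex.arg (ζ z / ζ y)) → ∀ ε : ℝ,
        Complex.arg (-(ζ z / ζ y)) = Complex.arg (ζ z / ζ y) + ε →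
        f z = -(1 / (2 * Real.pi)) • (b + ε • j w v) := by
      intro z hz ε hε
      simp only [f]
      congr 1
      rw [← Finset.add_sum_erase N _ hvN, hcut, hε,
        Finset.sum_congr rfl fun v' hv' => by rw [hz v' hv', add_smul],
        Finset.sum_add_distrib, ← Finset.smul_sum, hsum1, ← hb, add_smul, smul_neg]
      abel
    have hπ : Real.pi ≠ 0 := Real.pi_ne_zero
    refine ⟨-(1 / (2 * Real.pi)) • (b + Real.pi • j w v), nhdsWithin_le_nhds ?_⟩
    have hev := (eventually_all_finset (N.erase v)).2 fun v' hv' =>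
      hstep v' (Finset.mem_of_mem_erase hv') (hother v' hv')
    filter_upwards [hev] with z hz
    refine ⟨fun h => ?_, fun h => ?_⟩
    · have h1 : 0 < (ζ z / ζ y).im := by rw [him]; positivity
      rw [hform z hz (-Real.pi) (Complex.arg_neg_eq_arg_sub_pi_of_im_pos h1)]
      match_scalars
      · ring
      · field_simp
        norm_num
    · have h1 : (ζ z / ζ y).im < 0 := by
        rw [him]
        exact div_neg_of_neg_of_pos (mul_neg_of_pos_of_neg hr h) hnsq
      exact hform z hz _ (Complex.arg_neg_eq_arg_add_pi_of_im_neg h1)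
  refine ⟨fun hyS => ?_, fun u v huv hyo => ?_⟩
  · have hslit : ∀ v ∈ N, -(ζ y / c v) ∈ Complex.slitPlane := by
      intro v hv
      by_contra h
      refine hyS (F.mem_skeleton.2 ⟨s(w, v), hN.1 hv, ?_⟩)
      rw [edgeSegment_mk]
      exact openSegment_subset_segment ℝ _ _ (hseg v hv h)
    refine ⟨f y, nhdsWithin_le_nhds ?_⟩
    have hev := (eventually_all_finset N).2 fun v hv => hstep v hv (hslit v hv)
    filter_upwards [hev] with z hz
    simp only [f]
    congr 1
    rw [Finset.sum_congr rfl fun v' hv' => by rw [hz v' hv', add_smul],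
      Finset.sum_add_distrib, ← Finset.smul_sum, hsum', smul_zero, add_zero]
  · have hmem : y ∈ edgeSegment F.p s(u, v) := by
      rw [edgeSegment_mk]
      exact openSegment_subset_segment ℝ _ _ hyo
    have hw := F.mem_of_p_mem_edgeSegment (e := s(u, v)) huv (hnear _ huv hmem)
    rcases Sym2.mem_iff.1 hw with rfl | rfl
    · exact hray v huv hyo
    · exact exists_jump_symm (hanti _ _ huv.symm)
        (hray u huv.symm (openSegment_symm ℝ (F.p u) (F.p w) ▸ hyo))

/-- Jumps that are antisymmetric and sum to zero around each vertex are those of a function. -/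
theorem exists_localSolution_everywhere (hanti : ∀ u v, F.graph.Adj u v → j v u = -j u v)
    (hsum : ∀ w, ∑ v ∈ (F.finite_degree w).toFinset, j w v = 0) :
    ∃ f, ∀ x, F.LocalSolution j f x := by
  refine exists_global_solution F.dense_compl_skeleton (F.LocalSolution j)
    (fun f x h => h.eventually) (fun f g x hfg h => h.congr hfg) (fun f x c h => h.add_const c)
    (fun f g x hf hg => ?_) (fun x => ?_)
  · obtain ⟨O, hO, hOo, hx⟩ := _root_.mem_nhds_iff.1 (hf.1.and hg.1)
    exact constNear_of_hasJumpsAt hOo (fun y hy _ => (hO hy).1.sub (hO hy).2)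
      (fun _ _ _ _ _ _ => rfl) hx
  · by_cases hx : x ∈ F.skeleton
    · by_cases hp : x ∈ range F.p
      · obtain ⟨w, rfl⟩ := hp
        exact exists_localSolution_vertex hanti w (hsum w)
      · obtain ⟨u, v, huv, hxo⟩ := F.exists_mem_openSegment hx hp
        exact exists_localSolution_openSegment hanti huv hxo
    · exact exists_localSolution_off_skeleton hx

end Jumps

end PeriodicFramework

namespace PeriodicFramework

open Set Filter Metric

variable {V : Type*} {F : PeriodicFramework V}

/-! ### Potentials: the coefficients of a lifting -/

theorem inner_perp (a b : Plane) : ⟪perp a, b⟫_ℝ = det2 a b := by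
  simp [PiLp.inner_apply, Fin.sum_univ_two, det2]
  ring

variable (F) in
/-- The change of `(ν, C)` from the right to the left of the edge `(u, v)`. -/
noncomputable def stressJump (s : Sym2 V → ℝ) (u v : V) : Plane × ℝ :=
  (s s(u, v) • perp (F.p v - F.p u), -(s s(u, v) * det2 (F.p v) (F.p u)))

theorem stressJump_swap (s : Sym2 V → ℝ) (u v : V) :
    F.stressJump s v u = -F.stressJump s u v := by
  rw [stressJump, stressJump, Sym2.eq_swap]
  refine Prod.ext (Plane.ext' ?_ ?_) ?_
  · simp
    ring
  · simp
    ring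
  · simp [det2]
    ring

/-- The first component is the rotated equilibrium condition. The second also follows from it, since
`-|p v p w| = |p w (p v - p w)|` is linear in `p v - p w`. -/
theorem sum_stressJump {s : Sym2 V → ℝ} (hs : F.IsEquilibriumStress s) (w : V) :
    ∑ v ∈ (F.finite_degree w).toFinset, F.stressJump s w v = 0 := by
  have hi : ∀ i, ∑ v ∈ (F.finite_degree w).toFinset,
      s s(w, v) * (F.p v i - F.p w i) = 0 := fun i => by
    simpa using congrArg (fun a : Plane => a i) (hs w)
  refine Prod.ext (Plane.ext' ?_ ?_) ?_
  · rw [Prod.fst_sum]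
    simp only [stressJump, WithLp.ofLp_sum, Finset.sum_apply]
    refine Eq.trans ?_ (neg_eq_zero.2 (hi 1))
    rw [← Finset.sum_neg_distrib]
    refine Finset.sum_congr rfl fun v _ => ?_
    simp
    ring
  · rw [Prod.fst_sum]
    simp only [stressJump, WithLp.ofLp_sum, Finset.sum_apply]
    simpa using hi 0
  · rw [Prod.snd_sum]
    have h : ∀ v, (F.stressJump s w v).2 = F.p w 0 * (s s(w, v) * (F.p v 1 - F.p w 1)) -
        F.p w 1 * (s s(w, v) * (F.p v 0 - F.p w 0)) := fun v => by
      simp [stressJump, det2]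
      ring
    simp only [h, Finset.sum_sub_distrib, ← Finset.mul_sum, hi]
    simp

/-- The affine functions on both sides of an edge agree along it. -/
theorem inner_stressJump (s : Sym2 V → ℝ) {u v : V} {x : Plane}
    (hx : x ∈ segment ℝ (F.p u) (F.p v)) :
    ⟪(F.stressJump s u v).1, x⟫_ℝ + (F.stressJump s u v).2 = 0 := by
  have h := det2_eq_zero_of_mem_segment hx
  rw [stressJump, real_inner_smul_left, inner_perp]
  simp only [det2, PiLp.sub_apply] at h ⊢
  linear_combination s s(u, v) * h

variable (F) in
/-- The pairs `(ν_U, C_U)` change by the stress jumps along all tetrads. -/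
def IsPotential (s : Sym2 V → ℝ) (g : F.Face → Plane × ℝ) : Prop :=
  ∀ u v U W, F.IsTetrad u v U W → g W - g U = F.stressJump s u v

theorem midpoint_mem_openSegment (u v : V) :
    midpoint ℝ (F.p u) (F.p v) ∈ openSegment ℝ (F.p u) (F.p v) := by
  rw [openSegment_eq_image_lineMap]
  exact ⟨1 / 2, by norm_num, by rw [one_div]; rfl⟩

/-- The potential reads off the constant value on each face of a global solution `f`; `f` is
retained because its local boundedness gives continuity of the height. -/
theorem exists_isPotential {s : Sym2 V → ℝ} (hs : F.IsEquilibriumStress s) :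
    ∃ g, F.IsPotential s g ∧ ∃ f : Plane → Plane × ℝ,
      (∀ x, F.LocalSolution (F.stressJump s) f x) ∧ ∀ U, ∀ z ∈ U.1, f z = g U := by
  obtain ⟨f, hf⟩ := exists_localSolution_everywhere (F := F) (j := F.stressJump s)
    (fun u v _ => stressJump_swap s u v) (sum_stressJump hs)
  have hjump : ∀ x, F.HasJumpsAt (F.stressJump s) f x := fun x => (hf x).1.self_of_nhds
  have hg : ∀ (U : F.Face), ∀ z ∈ U.1, f z = f U.nonempty.some := fun U z hz =>
    U.isPreconnected.eq_of_constNear F.dense_compl_skeleton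
      (fun y hy => (hjump y).1 (U.notMem_skeleton hy)) hz (U.notMem_skeleton hz)
      U.nonempty.some_mem (U.notMem_skeleton U.nonempty.some_mem)
  refine ⟨fun U => f U.nonempty.some, fun u v U W hT => ?_, f, hf, hg⟩
  have hy := F.midpoint_mem_openSegment u v
  obtain ⟨a, ha⟩ := (hjump _).2 u v hT.1 hy
  rw [eventually_nhdsWithin_iff] at ha
  obtain ⟨ε, ⟨⟨h1, h2⟩, h3⟩, hε⟩ := (((hT.2 _ hy).and
    ((tendsto_add_smul_perp _ (F.p v - F.p u)).eventually ha)).and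
    ((tendsto_sub_smul_perp _ (F.p v - F.p u)).eventually ha)).and self_mem_nhdsWithin |>.exists
  have hW := (h2 (W.notMem_skeleton h1.1)).1 (F.det2_add_smul_perp_pos hT.1 hy hε)
  have hU := (h3 (U.notMem_skeleton h1.2)).2 (F.det2_sub_smul_perp_neg hT.1 hy hε)
  change f W.nonempty.some - f U.nonempty.some = _
  rw [← hg W _ h1.1, ← hg U _ h1.2, hW, hU, add_sub_cancel_left]

theorem IsPotential.exists_localSolution {s : Sym2 V → ℝ} (hs : F.IsEquilibriumStress s)
    {g : F.Face → Plane × ℝ} (hg : F.IsPotential s g) : ∃ f : Plane → Plane × ℝ,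
      (∀ x, F.LocalSolution (F.stressJump s) f x) ∧ ∀ U, ∀ z ∈ U.1, f z = g U := by
  obtain ⟨g₀, hg₀, f, hf, hfg⟩ := exists_isPotential hs
  obtain ⟨x, hx⟩ := F.dense_compl_skeleton.nonempty
  let U₀ := F.faceAt x hx
  refine ⟨fun z => f z + (g U₀ - g₀ U₀), fun x => (hf x).add_const _, fun U z hz => ?_⟩
  have h := sub_eq_sub_of_tetrads (g := g) (h := g₀)
    (fun u v U W hT => (hg u v U W hT).trans (hg₀ u v U W hT).symm) U₀ U
  change f z + (g U₀ - g₀ U₀) = g U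
  rw [hfg U z hz, add_sub_left_comm, ← h]
  abel

theorem IsPotential.add_const {s : Sym2 V → ℝ} {g : F.Face → Plane × ℝ}
    (hg : F.IsPotential s g) (c : Plane × ℝ) : F.IsPotential s fun U => g U + c :=
  fun u v U W hT => by rw [add_sub_add_right_eq_sub, hg u v U W hT]

/-- Write `ν·z + C = (ν·x + C) + ν·(z - x)`. All edges near `x` contain `x`, so the first term has
no jumps there and is constant near `x`; the second tends to zero because `ν` is bounded near `x`.
-/
theorem exists_tendsto_height {s : Sym2 V → ℝ} {f : Plane → Plane × ℝ} {x : Plane}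
    (hf : F.LocalSolution (F.stressJump s) f x) :
    ∃ c, Tendsto (fun z => ⟪(f z).1, z⟫_ℝ + (f z).2) (𝓝[F.skeletonᶜ] x) (𝓝 c) := by
  let φ : Plane × ℝ →+ ℝ :=
    { toFun := fun m => ⟪m.1, x⟫_ℝ + m.2
      map_zero' := by simp
      map_add' := fun m n => by
        simp only [Prod.fst_add, Prod.snd_add, inner_add_left]
        ring }
  obtain ⟨hjump, R, hR⟩ := hf
  obtain ⟨O, hO, hOo, hx⟩ :=
    _root_.mem_nhds_iff.1 (hjump.and (F.eventually_mem_edgeSegment x))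
  obtain ⟨c, hc⟩ : ConstNear F.skeleton (fun z => φ (f z) + 0) x := by
    refine constNear_of_hasJumpsAt hOo (fun y hy _ => (hO hy).1.map φ 0) ?_ hx
    intro y hy u v huv hyo
    have hxe := (hO hy).2 s(u, v) huv (by
      rw [edgeSegment_mk]
      exact openSegment_subset_segment ℝ _ _ hyo)
    rw [edgeSegment_mk] at hxe
    exact inner_stressJump s hxe
  refine ⟨c, ?_⟩
  have hsmall : Tendsto (fun z => ⟪(f z).1, z - x⟫_ℝ) (𝓝[F.skeletonᶜ] x) (𝓝 0) := by
    have hlim : Tendsto (fun z : Plane => R * ‖z - x‖) (𝓝[F.skeletonᶜ] x) (𝓝 0) := by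
      have : Continuous fun z : Plane => R * ‖z - x‖ := by fun_prop
      simpa using (this.tendsto x).mono_left nhdsWithin_le_nhds
    refine squeeze_zero_norm' ?_ hlim
    filter_upwards [hR] with z hz
    refine (norm_inner_le_norm _ _).trans ?_
    gcongr
    exact (norm_fst_le _).trans hz
  have := (tendsto_nhds_of_eventually_eq hc).add hsmall
  rw [add_zero] at this
  refine this.congr fun z => ?_
  simp only [φ, AddMonoidHom.coe_mk, ZeroHom.coe_mk, inner_sub_right]
  ring

theorem IsPotential.exists_lifting {s : Sym2 V → ℝ} (hs : F.IsEquilibriumStress s)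
    {g : F.Face → Plane × ℝ} (hg : F.IsPotential s g) :
    ∃ L : F.Lifting, ∀ U, L.normal U = (g U).1 ∧ L.const U = (g U).2 := by
  obtain ⟨f, hf, hfg⟩ := hg.exists_localSolution hs
  refine ⟨⟨extendFrom F.skeletonᶜ fun z => ⟪(f z).1, z⟫_ℝ + (f z).2, fun U => (g U).1,
    fun U => (g U).2, continuous_extendFrom F.dense_compl_skeleton
      fun x => exists_tendsto_height (hf x), fun U q hq => ?_⟩, fun U => ⟨rfl, rfl⟩⟩
  refine extendFrom_eq (F.dense_compl_skeleton q) ?_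
  have hc : Continuous fun z : Plane => ⟪(g U).1, z⟫_ℝ + (g U).2 := by fun_prop
  refine ((hc.tendsto q).mono_left nhdsWithin_le_nhds).congr' ?_
  filter_upwards [nhdsWithin_le_nhds (U.isOpen.mem_nhds hq)] with z hz
  rw [hfg U z hz]

/-! ### Liftings -/

theorem Lifting.ext_of_coefficients {L L' : F.Lifting} (hν : ∀ U, L.normal U = L'.normal U)
    (hC : ∀ U, L.const U = L'.const U) : L = L' := by
  have hH : L.height = L'.height := by
    refine L.continuous_height.ext_on F.dense_compl_skeleton L'.continuous_height fun x hx => ?_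
    rw [L.height_eq _ x (F.mem_faceAt hx), L'.height_eq _ x (F.mem_faceAt hx), hν, hC]
  obtain ⟨H, ν, C, _, _⟩ := L
  obtain ⟨H', ν', C', _, _⟩ := L'
  obtain rfl : H = H' := hH
  obtain rfl : ν = ν' := funext hν
  obtain rfl : C = C' := funext hC
  rfl

/-- Continuity of the height at `x`, approached along the normal from both sides. -/
theorem Lifting.const_sub_const (L : F.Lifting) {u v : V} {U W : F.Face}
    (hT : F.IsTetrad u v U W) {x : Plane} (hx : x ∈ openSegment ℝ (F.p u) (F.p v)) :
    L.const W - L.const U = -⟪L.normal W - L.normal U, x⟫_ℝ := by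
  have hlim : ∀ (A : F.Face) {z : ℝ → Plane}, Tendsto z (𝓝[>] 0) (𝓝 x) →
      (∀ᶠ ε in 𝓝[>] (0 : ℝ), z ε ∈ A.1) → L.height x = ⟪L.normal A, x⟫_ℝ + L.const A := by
    intro A z hz hA
    have hc : Continuous fun z : Plane => ⟪L.normal A, z⟫_ℝ + L.const A := by fun_prop
    refine tendsto_nhds_unique ((L.continuous_height.tendsto x).comp hz)
      (((hc.tendsto x).comp hz).congr' ?_)
    filter_upwards [hA] with ε hε
    exact (L.height_eq A _ hε).symm
  have hW := hlim W (tendsto_add_smul_perp x (F.p v - F.p u)) ((hT.2 x hx).mono fun _ h => h.1)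
  have hU := hlim U (tendsto_sub_smul_perp x (F.p v - F.p u)) ((hT.2 x hx).mono fun _ h => h.2)
  rw [inner_sub_left]
  linarith

theorem snd_eq_of_fst_eq {s : Sym2 V → ℝ} (L : F.Lifting) {u v : V} {U W : F.Face}
    (hT : F.IsTetrad u v U W) (h : L.normal W - L.normal U = (F.stressJump s u v).1) :
    L.const W - L.const U = (F.stressJump s u v).2 := by
  have hy := F.midpoint_mem_openSegment u v
  rw [L.const_sub_const hT hy, h]
  linarith [inner_stressJump (F := F) s (openSegment_subset_segment ℝ _ _ hy)]

theorem Lifting.Induces.isPotential {L : F.Lifting} {s : Sym2 V → ℝ} (h : L.Induces s) :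
    F.IsPotential s fun U => (L.normal U, L.const U) :=
  fun u v U W hT => Prod.ext (h u v U W hT) (snd_eq_of_fst_eq L hT (h u v U W hT))

/-! ### Periods -/

theorem IsPotential.detSum_eq {s : Sym2 V → ℝ} {g : F.Face → Plane × ℝ} (hg : F.IsPotential s g)
    {U W : F.Face} (P : F.FacePath U W) : P.detSum s = (g U).2 - (g W).2 := by
  induction P with
  | nil => simp [FacePath.detSum]
  | cons u v hT P ih =>
    have h := congrArg Prod.snd (hg _ _ _ _ hT)
    simp only [stressJump, Prod.snd_sub] at h
    rw [FacePath.detSum, ih]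
    linarith

theorem IsPotential.perp_edgeSum_eq {s : Sym2 V → ℝ} {g : F.Face → Plane × ℝ}
    (hg : F.IsPotential s g) {U W : F.Face} (P : F.FacePath U W) :
    perp (P.edgeSum s) = (g W).1 - (g U).1 := by
  induction P with
  | nil => exact Plane.ext' (by simp [FacePath.edgeSum]) (by simp [FacePath.edgeSum])
  | cons u v hT P ih =>
    have h := congrArg Prod.fst (hg _ _ _ _ hT)
    simp only [stressJump, Prod.fst_sub] at h
    rw [← sub_add_sub_cancel _ (g _).1, ← ih, h, FacePath.edgeSum]
    refine Plane.ext' ?_ ?_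
    · simp
      ring
    · simp
      ring

/-- A vector is determined by its inner products with the periods. -/
theorem eq_of_inner_lattice {a b : Plane}
    (h : ∀ m : F.lattice, ⟪a, (m : Plane)⟫_ℝ = ⟪b, (m : Plane)⟫_ℝ) : a = b := by
  have hle : Submodule.span ℝ (F.π.range : Set Plane) ≤ (ℝ ∙ (a - b))ᗮ := by
    refine Submodule.span_le.2 fun x hx => ?_
    rw [SetLike.mem_coe, Submodule.mem_orthogonal_singleton_iff_inner_right, inner_sub_left,
      sub_eq_zero]
    exact h ⟨x, hx⟩
  rw [F.spans] at hle
  have h0 := hle (Submodule.mem_top (x := a - b))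
  rw [Submodule.mem_orthogonal_singleton_iff_inner_right, inner_self_eq_zero] at h0
  exact sub_eq_zero.1 h0

/-- The map to the two inner products is injective, as the generators determine those with the whole
spanning lattice; dimensions are equal, so it is onto. -/
theorem exists_inner_eq {l : Fin 2 → F.lattice} (hl : AddSubgroup.closure (range l) = ⊤)
    (c : Fin 2 → ℝ) : ∃ ν : Plane, ∀ j, ⟪ν, (l j : Plane)⟫_ℝ = c j := by
  let T : Plane →ₗ[ℝ] (Fin 2 → ℝ) :=
    { toFun := fun ν j => ⟪ν, (l j : Plane)⟫_ℝ
      map_add' := fun a b => by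
        ext j
        simp [inner_add_left]
      map_smul' := fun a b => by
        ext j
        simp [real_inner_smul_left] }
  have hinj : Function.Injective T := by
    intro a b hab
    refine eq_of_inner_lattice (F := F) fun m => ?_
    let A : F.lattice →+ ℝ := ((innerₗ Plane a).toAddMonoidHom).comp F.lattice.subtype
    let B : F.lattice →+ ℝ := ((innerₗ Plane b).toAddMonoidHom).comp F.lattice.subtype
    have hAB : A = B := by
      refine AddMonoidHom.eq_of_eqOn_dense hl ?_
      rintro _ ⟨j, rfl⟩
      exact congrFun hab j
    exact DFunLike.congr_fun hAB m
  have hsurj := (LinearMap.injective_iff_surjective_of_finrank_eq_finrank (by simp)).1 hinj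
  obtain ⟨ν, hν⟩ := hsurj c
  exact ⟨ν, fun j => congrFun hν j⟩

theorem stressJump_smul {s : Sym2 V → ℝ} (hinv : F.IsInvariantStress s) {u v : V}
    (huv : F.graph.Adj u v) (γ : F.Γ) (l : F.lattice)
    (hl : (l : Plane) = F.π (Additive.ofMul γ)) :
    F.stressJump s ((γ : F.graph ≃g F.graph) u) ((γ : F.graph ≃g F.graph) v) =
      F.stressJump s u v - (0, ⟪(F.stressJump s u v).1, (l : Plane)⟫_ℝ) := by
  have h := hinv γ γ.2 s(u, v) huv
  rw [Sym2.map_mk] at h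
  rw [stressJump, stressJump, h, F.p_smul, F.p_smul, ← hl, add_sub_add_right_eq_sub,
    real_inner_smul_left, inner_perp]
  refine Prod.ext (by simp) ?_
  simp [det2]
  ring

theorem exists_Γ (l : F.lattice) : ∃ γ : F.Γ, (l : Plane) = F.π (Additive.ofMul γ) := by
  obtain ⟨l, γ, rfl⟩ := l
  exact ⟨γ.toMul, rfl⟩

/-- The jumps of `ν` are invariant under periods, so `ν` and its translate differ by a constant. -/
theorem IsPotential.normal_translate {s : Sym2 V → ℝ} (hinv : F.IsInvariantStress s)
    {g : F.Face → Plane × ℝ} (hg : F.IsPotential s g) (l : F.lattice) (U W : F.Face) :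
    (g (F.translate W l)).1 - (g (F.translate U l)).1 = (g W).1 - (g U).1 := by
  obtain ⟨γ, hγ⟩ := exists_Γ l
  refine sub_eq_sub_of_tetrads (g := fun U => (g (F.translate U l)).1) (h := fun U => (g U).1)
    (fun u v U W hT => ?_) U W
  have h := congrArg Prod.fst (hg _ _ _ _ (hT.translate γ l hγ))
  have h' := congrArg Prod.fst (hg _ _ _ _ hT)
  rw [stressJump_smul hinv hT.1 γ l hγ] at h
  simp only [Prod.fst_sub, sub_zero] at h h'
  rw [h, h']

/-- Translation by `l` lowers the jump of `C` by the inner product of the jump of `ν` with `l`; the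
term `ν·l` compensates for it. -/
theorem IsPotential.const_translate {s : Sym2 V → ℝ} (hinv : F.IsInvariantStress s)
    {g : F.Face → Plane × ℝ} (hg : F.IsPotential s g) (l : F.lattice) (U W : F.Face) :
    ((g (F.translate W l)).2 + ⟪(g W).1, (l : Plane)⟫_ℝ) -
      ((g (F.translate U l)).2 + ⟪(g U).1, (l : Plane)⟫_ℝ) = (g W).2 - (g U).2 := by
  obtain ⟨γ, hγ⟩ := exists_Γ l
  refine sub_eq_sub_of_tetrads
    (g := fun U => (g (F.translate U l)).2 + ⟪(g U).1, (l : Plane)⟫_ℝ) (h := fun U => (g U).2)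
    (fun u v U W hT => ?_) U W
  have h := congrArg Prod.snd (hg _ _ _ _ (hT.translate γ l hγ))
  have h' := hg _ _ _ _ hT
  rw [stressJump_smul hinv hT.1 γ l hγ, ← h'] at h
  simp only [Prod.fst_sub, Prod.snd_sub, inner_sub_left] at h
  linarith

variable (F) in
/-- `(ν, C)` satisfies the conditions for a periodic lifting. -/
def IsPeriodicPotential (g : F.Face → Plane × ℝ) : Prop :=
  ∀ U l, (g (F.translate U l)).1 = (g U).1 ∧
    ⟪(g U).1, (l : Plane)⟫_ℝ = (g U).2 - (g (F.translate U l)).2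

/-- The change of `ν` along a face-path is the rotated edge sum, which vanishes for the given paths.
`normal_translate` passes from `U₀` to every face, and the generators give every period. -/
theorem IsPotential.normal_periodic {s : Sym2 V → ℝ} (hinv : F.IsInvariantStress s)
    {g : F.Face → Plane × ℝ} (hg : F.IsPotential s g) {U₀ : F.Face} {l : Fin 2 → F.lattice}
    (hl : AddSubgroup.closure (range l) = ⊤) (P : ∀ j, F.FacePath U₀ (F.translate U₀ (l j)))
    (hP : ∀ j, (P j).edgeSum s = 0) (U : F.Face) (m : F.lattice) :
    (g (F.translate U m)).1 = (g U).1 := by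
  have hm : m ∈ AddSubgroup.closure (range l) := hl ▸ AddSubgroup.mem_top m
  induction hm using AddSubgroup.closure_induction generalizing U with
  | mem _ h =>
    obtain ⟨j, rfl⟩ := h
    have h1 := hg.perp_edgeSum_eq (P j)
    have h0 : perp 0 = 0 := Plane.ext' (by simp) (by simp)
    rw [hP, h0] at h1
    have h2 := hg.normal_translate hinv (l j) U₀ U
    rw [← sub_eq_zero.1 h1.symm] at h2
    have h3 := sub_eq_zero.1 h1.symm
    rw [← sub_eq_zero] at h2 ⊢
    rw [← h2, h3]
    abel
  | zero => rw [translate_zero]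
  | add a b _ _ ha hb => rw [← translate_translate, hb, ha]
  | neg a _ ha => rw [← ha (F.translate U (-a)), translate_translate, neg_add_cancel,
      translate_zero]

theorem exists_periodic_potential {s : Sym2 V → ℝ} (hs : F.IsEquilibriumStress s)
    (hinv : F.IsInvariantStress s) {U₀ : F.Face} {l : Fin 2 → F.lattice}
    (hl : AddSubgroup.closure (range l) = ⊤) (P : ∀ j, F.FacePath U₀ (F.translate U₀ (l j)))
    (hP : ∀ j, (P j).edgeSum s = 0) :
    ∃ g, F.IsPotential s g ∧ F.IsPeriodicPotential g := by
  obtain ⟨g, hg, -⟩ := exists_isPotential hs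
  have hper := hg.normal_periodic hinv hl P hP
  have hκ : ∀ (U : F.Face) (m : F.lattice),
      (g (F.translate U m)).2 + ⟪(g U).1, (m : Plane)⟫_ℝ - (g U).2 =
      (g (F.translate U₀ m)).2 + ⟪(g U₀).1, (m : Plane)⟫_ℝ - (g U₀).2 := fun U m => by
    linarith [hg.const_translate hinv m U₀ U]
  -- The obstruction to periodicity. Additivity combines its independence of the face, applied at
  -- `U₀ + a`, with the periodicity of `ν`.
  let κ : F.lattice →+ ℝ := AddMonoidHom.mk'
    (fun m => (g (F.translate U₀ m)).2 + ⟪(g U₀).1, (m : Plane)⟫_ℝ - (g U₀).2) fun a b => by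
      have h := hκ (F.translate U₀ a) b
      rw [translate_translate, hper] at h
      rw [AddSubgroup.coe_add, inner_add_right]
      linarith
  -- Adding `ν` to every normal changes `κ m` by `ν·m`, so matching `-κ` on the generators cancels
  -- it on the whole lattice.
  obtain ⟨ν, hν⟩ := exists_inner_eq hl fun j => -κ (l j)
  have hzero : κ + ((innerₗ Plane ν).toAddMonoidHom).comp F.lattice.subtype = 0 := by
    refine AddMonoidHom.eq_of_eqOn_dense hl ?_
    rintro _ ⟨j, rfl⟩
    change κ (l j) + ⟪ν, (l j : Plane)⟫_ℝ = 0
    rw [hν, add_neg_cancel]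
  refine ⟨fun U => g U + (ν, 0), hg.add_const _, fun U m => ⟨?_, ?_⟩⟩
  · simp only [Prod.fst_add, hper]
  · have h : κ m + ⟪ν, (m : Plane)⟫_ℝ = 0 := DFunLike.congr_fun hzero m
    have h2 : κ m = (g (F.translate U m)).2 + ⟪(g U).1, (m : Plane)⟫_ℝ - (g U).2 := (hκ U m).symm
    simp only [Prod.fst_add, Prod.snd_add, inner_add_left]
    linarith

/-- The period relations determine the coefficients of a lifting up to a constant height. -/
theorem Lifting.HasPeriodRelations.coefficients_eq {s : Sym2 V → ℝ} {L : F.Lifting}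
    (hL : L.HasPeriodRelations s) {g : F.Face → Plane × ℝ} (hg : F.IsPotential s g)
    (hper : F.IsPeriodicPotential g) :
    (∀ U, L.normal U = (g U).1) ∧ ∀ U W, L.const W - L.const U = (g W).2 - (g U).2 := by
  have hν : ∀ U, L.normal U = (g U).1 := fun U => eq_of_inner_lattice fun m => by
    obtain ⟨P⟩ := nonempty_facePath U (F.translate U m)
    rw [(hL U m P).1, hg.detSum_eq, (hper U m).2]
  refine ⟨hν, sub_eq_sub_of_tetrads fun u v U W hT => ?_⟩
  have h := hg u v U W hT
  rw [snd_eq_of_fst_eq (s := s) L hT (by rw [hν, hν, ← h, Prod.fst_sub]), ← h, Prod.snd_sub]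

end PeriodicFramework

/-! ### Existence, uniqueness and characterization of the periodic lifting -/

open PeriodicFramework in
theorem mainTheorem7 {V : Type*} (F : PeriodicFramework V) (s : Sym2 V → ℝ)
    (hs : F.IsEquilibriumStress s) (hinv : F.IsInvariantStress s)
    (U₀ : F.Face) (l : Fin 2 → F.lattice) (hl : AddSubgroup.closure (Set.range l) = ⊤)
    (P : ∀ j, F.FacePath U₀ (F.translate U₀ (l j))) (hP : ∀ j, (P j).edgeSum s = 0) :
    (∀ (U : F.Face) (m : F.lattice), Nonempty (F.FacePath U (F.translate U m))) ∧
    (∀ C₀ : ℝ, ∃! L : F.Lifting, L.HasPeriodRelations s ∧ L.const U₀ = C₀) ∧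
    (∀ L : F.Lifting, L.HasPeriodRelations s ↔ L.IsPeriodic ∧ L.Induces s) := by
  obtain ⟨g, hg, hper⟩ := exists_periodic_potential hs hinv hl P hP
  refine ⟨fun U m => nonempty_facePath U _, fun C₀ => ?_, fun L => ⟨fun hL => ⟨?_, ?_⟩, ?_⟩⟩
  -- A shift of all constants preserves the jumps and the period relations and normalizes the height
  -- at `U₀`.
  · obtain ⟨L, hL⟩ := (hg.add_const (0, C₀ - (g U₀).2)).exists_lifting hs
    have hν : ∀ U, L.normal U = (g U).1 := fun U => by simp [(hL U).1]
    have hC : ∀ U, L.const U = (g U).2 + (C₀ - (g U₀).2) := fun U => by simp [(hL U).2]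
    refine ⟨L, ⟨fun U m Q => ?_, by rw [hC]; ring⟩, fun L' ⟨hL', hC'⟩ => ?_⟩
    · rw [hg.detSum_eq, hν, (hper U m).2, hC, hC]
      exact ⟨rfl, by ring⟩
    · obtain ⟨hν', hd⟩ := hL'.coefficients_eq hg hper
      refine Lifting.ext_of_coefficients (fun U => by rw [hν', hν]) fun U => ?_
      rw [hC]
      linarith [hd U₀ U]
  · obtain ⟨hν, hd⟩ := hL.coefficients_eq hg hper
    intro x m
    have hc : Continuous fun x => L.height (x + (m : Plane)) :=
      L.continuous_height.comp (by fun_prop)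
    refine congrFun (hc.ext_on F.dense_compl_skeleton L.continuous_height fun y hy => ?_) x
    have hyU := F.mem_faceAt hy
    have hym : y + m ∈ (F.translate (F.faceAt y hy) m).1 := ⟨y, hyU, rfl⟩
    simp only [L.height_eq _ _ hyU, L.height_eq _ _ hym, hν, (hper _ m).1, inner_add_right,
      (hper _ m).2]
    linarith [hd (F.faceAt y hy) (F.translate (F.faceAt y hy) m)]
  · obtain ⟨hν, -⟩ := hL.coefficients_eq hg hper
    intro u v U W hT
    rw [hν, hν, ← Prod.fst_sub, hg u v U W hT, stressJump]
  · rintro ⟨hLp, hLs⟩ U m Q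
    have hd := hLs.isPotential.detSum_eq Q
    have hn : L.normal (F.translate U m) = L.normal U :=
      hLs.isPotential.normal_periodic hinv hl P hP U m
    obtain ⟨y, hy⟩ := U.nonempty
    -- With equal normals on `U` and `U + m`, equality of the heights at `y` and `y + m` reads
    -- `ν_U·m = C_U - C_{U+m}`.
    have h := hLp y m
    rw [L.height_eq _ _ hy, L.height_eq (F.translate U m) _ ⟨y, hy, rfl⟩, hn,
      inner_add_right] at h
    exact ⟨by linarith, hd⟩
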